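/- Let $\Sigma$ be a compact connected Riemann surface of genus $2$ with an antiholomorphic involution $\tau$. Call a holomorphic vector bundle $E$ on $\Sigma$ real if $\tau^*(\overline{E})\cong E$, and a divisor $D$ real if $\tau(D)=D$. Let $\Lambda$ be a real line bundle of degree $1$, and let $E$ be a real semistable bundle of rank $2$ with $\det E\cong\Lambda$ (that is, $E\in M_\Lambda(2,1)^\tau$). Suppose that $E$ is generic in the sense that $L_0\otimes E\not\cong E$ for every nontrivial holomorphic line bundle $L_0$ with $L_0^{2}\cong\mathcal{O}_\Sigma$. Let $L$ be a line bundle of degree $0$ and let $$0\to L\to E\to L^{-1}\otimes\Lambda\to 0$$ be an extension, with extension class $e\in H^1(\Sigma,L^{2}\otimes\Lambda^{-1})$. The associated divisor $D\in\mathrm{Sym}^3(\Sigma)$ of the extension is the divisor of zeros of a section $s\in H^0(\Sigma,L^{-2}\otimes\Lambda\otimes K)$ spanning the line of those sections that are annihilated by $e$ under the Serre duality pairing $H^0(\Sigma,L^{-2}\otimes\Lambda\otimes K)\times H^1(\Sigma,L^{2}\otimes\Lambda^{-1})\to H^1(\Sigma,K)\cong\mathbb{C}$, where $K$ is the canonical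 bundle. Then $L$ is real if and only if $D$ is real. -/

import Mathlib

open scoped Manifold ContDiff Topology ComplexConjugate

universe u

noncomputable section

namespace RealCurve

/-! ### Holomorphic vector bundles on a Riemann surface -/

section Bundles

variable (X : Type u) [TopologicalSpace X] [ChartedSpace ℂ X]

/-- A holomorphic vector bundle with typical fibre `F` on `X`, given by an open cover trivialising
it and holomorphic transition functions. The fibre over `x` is `F`, read in the distinguished
trivialisation `core.indexAt x` around `x` (as in Mathlib's `VectorBundleCore.Fiber`). -/
structure HolBundle (F : Type) [NormedAddCommGroup F] [NormedSpace ℂ F] where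
  /-- the index set of the trivialising cover -/
  ι : Type u
  /-- the cover and the transition functions -/
  core : VectorBundleCore ℂ X F ι
  /-- the transition functions are holomorphic -/
  hol : core.IsContMDiff 𝓘(ℂ) ω

/-- Holomorphic line bundles. -/
abbrev HolLine := HolBundle X ℂ

/-- Holomorphic vector bundles of rank `n`. -/
abbrev HolVec (n : ℕ) := HolBundle X (Fin n → ℂ)

end Bundles

variable {X : Type u} [TopologicalSpace X] [ChartedSpace ℂ X]
  {F : Type} [NormedAddCommGroup F] [NormedSpace ℂ F]
  {F' : Type} [NormedAddCommGroup F'] [NormedSpace ℂ F']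

namespace HolBundle

/-- The set-theoretic section `s` read in the trivialisation `i`. -/
def localRep (E : HolBundle X F) (s : X → F) (i : E.ι) (x : X) : F :=
  E.core.coordChange (E.core.indexAt x) i x (s x)

/-- `s` is a holomorphic section of `E` over the open set `V`. -/
def IsHolSectionOn (E : HolBundle X F) (V : Set X) (s : X → F) : Prop :=
  ∀ i, ContMDiffOn 𝓘(ℂ) 𝓘(ℂ, F) ω (E.localRep s i) (V ∩ E.core.baseSet i)

/-- The space `H⁰(X, E)` of global holomorphic sections. -/
def H0 (E : HolBundle X F) : Submodule ℂ (X → F) where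
  carrier := {s | E.IsHolSectionOn Set.univ s}
  add_mem' {s t} hs ht i := ((hs i).add (ht i)).congr fun x _ => by simp [localRep]
  zero_mem' i := (contMDiffOn_const (c := (0 : F))).congr fun x _ => by simp [localRep]
  smul_mem' c s hs i :=
    (ContMDiffOn.smul (I := 𝓘(ℂ)) (f := fun _ : X => c) contMDiffOn_const (hs i)).congr
      fun x _ => by simp [localRep]

/-- The fibrewise linear maps `φ x : E_x → E'_x` form a holomorphic bundle map over the open set
`V`. -/
def IsHolMapOn (E : HolBundle X F) (E' : HolBundle X F') (V : Set X) (φ : X → F →L[ℂ] F') : Prop :=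
  ∀ i j, ContMDiffOn 𝓘(ℂ) 𝓘(ℂ, F →L[ℂ] F') ω
    (fun x => (E'.core.coordChange (E'.core.indexAt x) j x).comp
      ((φ x).comp (E.core.coordChange i (E.core.indexAt x) x)))
    (V ∩ (E.core.baseSet i ∩ E'.core.baseSet j))

/-- Holomorphic bundle maps `E → E'` over `X`. -/
structure Map (E : HolBundle X F) (E' : HolBundle X F') where
  /-- the map on fibres -/
  fib : X → F →L[ℂ] F'
  hol : E.IsHolMapOn E' Set.univ fib

/-- `E` and `E'` are isomorphic holomorphic bundles. -/
def Isom (E : HolBundle X F) (E' : HolBundle X F') : Prop :=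
  ∃ (f : E.Map E') (g : E'.Map E),
    ∀ x, (∀ v, g.fib x (f.fib x v) = v) ∧ ∀ w, f.fib x (g.fib x w) = w

/-- The trivial line bundle `𝒪`. -/
def trivialLine (X : Type u) [TopologicalSpace X] [ChartedSpace ℂ X] : HolLine X where
  ι := PUnit
  core := trivialVectorBundleCore ℂ X ℂ PUnit
  hol := ⟨fun _ _ => contMDiffOn_const⟩

theorem contMDiffOn_coordChange (E : HolBundle X F) (i j : E.ι) :
    ContMDiffOn 𝓘(ℂ) 𝓘(ℂ, F →L[ℂ] F) ω (E.core.coordChange i j)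
      (E.core.baseSet i ∩ E.core.baseSet j) :=
  E.hol.contMDiffOn_coordChange i j

/-- The transition functions of a line bundle as scalar functions. -/
def scalar (L : HolLine X) (i j : L.ι) (x : X) : ℂ := L.core.coordChange i j x 1

theorem contMDiffOn_scalar (L : HolLine X) (i j : L.ι) :
    ContMDiffOn 𝓘(ℂ) 𝓘(ℂ, ℂ) ω (L.scalar i j) (L.core.baseSet i ∩ L.core.baseSet j) :=
  (L.contMDiffOn_coordChange i j).clm_apply contMDiffOn_const

theorem scalar_self (L : HolLine X) (i : L.ι) {x : X} (hx : x ∈ L.core.baseSet i) :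
    L.scalar i i x = 1 := L.core.coordChange_self i x hx 1

theorem scalar_comp (L : HolLine X) (i j k : L.ι) {x : X}
    (hx : x ∈ L.core.baseSet i ∩ L.core.baseSet j ∩ L.core.baseSet k) :
    L.scalar j k x * L.scalar i j x = L.scalar i k x := by
  have h := L.core.coordChange_comp i j k x hx 1
  have h2 := (L.core.coordChange j k x).map_smul (L.core.coordChange i j x 1) 1
  simp only [smul_eq_mul, mul_one] at h2
  rw [h2] at h
  rw [mul_comm]
  exact h

/-- The tensor product `L ⊗ E` of a line bundle and a vector bundle: transition functions are
multiplied. In fibre coordinates the tensor of `a ∈ L_x` and `v ∈ E_x` is `a • v`. -/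
def tensor (L : HolLine X) (E : HolBundle X F) : HolBundle X F :=
  have key : ∀ p q : L.ι × E.ι, ContMDiffOn 𝓘(ℂ) 𝓘(ℂ, F →L[ℂ] F) ω
      (fun x => L.scalar p.1 q.1 x • E.core.coordChange p.2 q.2 x)
      ((L.core.baseSet p.1 ∩ E.core.baseSet p.2) ∩ (L.core.baseSet q.1 ∩ E.core.baseSet q.2)) :=
    fun p q => ((L.contMDiffOn_scalar p.1 q.1).mono fun _ hx => ⟨hx.1.1, hx.2.1⟩).smul
      ((E.contMDiffOn_coordChange p.2 q.2).mono fun _ hx => ⟨hx.1.2, hx.2.2⟩)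
  { ι := L.ι × E.ι
    core :=
      { baseSet := fun p => L.core.baseSet p.1 ∩ E.core.baseSet p.2
        isOpen_baseSet := fun p => (L.core.isOpen_baseSet _).inter (E.core.isOpen_baseSet _)
        indexAt := fun x => (L.core.indexAt x, E.core.indexAt x)
        mem_baseSet_at := fun x => ⟨L.core.mem_baseSet_at x, E.core.mem_baseSet_at x⟩
        coordChange := fun p q x => L.scalar p.1 q.1 x • E.core.coordChange p.2 q.2 x
        coordChange_self := fun p x hx v => by
          simp [L.scalar_self p.1 hx.1, E.core.coordChange_self p.2 x hx.2]
        continuousOn_coordChange := fun p q => (key p q).continuousOn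
        coordChange_comp := fun p q r x hx v => by
          have h1 := L.scalar_comp p.1 q.1 r.1 ⟨⟨hx.1.1.1, hx.1.2.1⟩, hx.2.1⟩
          have h2 := E.core.coordChange_comp p.2 q.2 r.2 x ⟨⟨hx.1.1.2, hx.1.2.2⟩, hx.2.2⟩ v
          simp [smul_smul, h2, ← h1, mul_comm] }
    hol := ⟨key⟩ }

/-- The dual (inverse) `L⁻¹` of a line bundle: transition functions are inverted. In fibre
coordinates the pairing of `L⁻¹_x` and `L_x` is multiplication. -/
def dual (L : HolLine X) : HolLine X :=
  have key : ∀ i j : L.ι, ContMDiffOn 𝓘(ℂ) 𝓘(ℂ, ℂ →L[ℂ] ℂ) ω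
      (fun x => L.core.coordChange j i x) (L.core.baseSet i ∩ L.core.baseSet j) :=
    fun i j => (L.contMDiffOn_coordChange j i).mono fun _ hx => ⟨hx.2, hx.1⟩
  { ι := L.ι
    core :=
      { baseSet := L.core.baseSet
        isOpen_baseSet := L.core.isOpen_baseSet
        indexAt := L.core.indexAt
        mem_baseSet_at := L.core.mem_baseSet_at
        coordChange := fun i j x => L.core.coordChange j i x
        coordChange_self := L.core.coordChange_self
        continuousOn_coordChange := fun i j => (key i j).continuousOn
        coordChange_comp := fun i j k x hx v => by
          have comm : ∀ A B : ℂ →L[ℂ] ℂ, A (B v) = B (A v) := fun A B => by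
            have hA : ∀ w, A w = w * A 1 := fun w => by
              simpa using A.map_smul w 1
            have hB : ∀ w, B w = w * B 1 := fun w => by
              simpa using B.map_smul w 1
            rw [hA (B v), hB v, hB (A v), hA v]; ring
          rw [comm]
          exact L.core.coordChange_comp k j i x ⟨⟨hx.2, hx.1.2⟩, hx.1.1⟩ v }
    hol := ⟨key⟩ }

theorem contDiff_clm_det (n : ℕ) :
    ContDiff ℂ ω (fun A : (Fin n → ℂ) →L[ℂ] (Fin n → ℂ) => A.det) := by
  have h : (fun A : (Fin n → ℂ) →L[ℂ] (Fin n → ℂ) => A.det) = fun A =>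
      ∑ σ : Equiv.Perm (Fin n), ((Equiv.Perm.sign σ : ℤ) : ℂ) *
        ∏ i, A (Pi.single i 1) (σ i) := by
    funext A
    have h1 : A.det = (LinearMap.toMatrix' (A : (Fin n → ℂ) →ₗ[ℂ] (Fin n → ℂ))).det := by
      rw [LinearMap.det_toMatrix']
    rw [h1, Matrix.det_apply']
    simp [LinearMap.toMatrix'_apply]
  rw [h]
  refine ContDiff.sum fun σ _ => contDiff_const.mul (contDiff_prod fun i _ => ?_)
  exact contDiff_pi.1 (contDiff_id.clm_apply contDiff_const) (σ i)

/-- The determinant line bundle `det E`. -/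
def det {n : ℕ} (E : HolVec X n) : HolLine X :=
  have key : ∀ i j : E.ι, ContMDiffOn 𝓘(ℂ) 𝓘(ℂ, ℂ →L[ℂ] ℂ) ω
      (fun x => (E.core.coordChange i j x).det • ContinuousLinearMap.id ℂ ℂ)
      (E.core.baseSet i ∩ E.core.baseSet j) := fun i j =>
    ((contDiff_clm_det n).contMDiff.comp_contMDiffOn (E.contMDiffOn_coordChange i j)).smul
      contMDiffOn_const
  { ι := E.ι
    core :=
      { baseSet := E.core.baseSet
        isOpen_baseSet := E.core.isOpen_baseSet
        indexAt := E.core.indexAt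
        mem_baseSet_at := E.core.mem_baseSet_at
        coordChange := fun i j x => (E.core.coordChange i j x).det • ContinuousLinearMap.id ℂ ℂ
        coordChange_self := fun i x hx v => by
          have : E.core.coordChange i i x = ContinuousLinearMap.id ℂ _ := by
            ext1 w; exact E.core.coordChange_self i x hx w
          simp [this, ContinuousLinearMap.det]
        continuousOn_coordChange := fun i j => (key i j).continuousOn
        coordChange_comp := fun i j k x hx v => by
          have : E.core.coordChange i k x
              = (E.core.coordChange j k x).comp (E.core.coordChange i j x) := by
            ext1 w; exact (E.core.coordChange_comp i j k x hx w).symm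
          simp [this, ContinuousLinearMap.det, LinearMap.det_comp, mul_assoc] }
    hol := ⟨key⟩ }

/-- The holomorphic tangent bundle. -/
def tangent (X : Type u) [TopologicalSpace X] [ChartedSpace ℂ X] [IsManifold 𝓘(ℂ) ω X] :
    HolLine X where
  ι := atlas ℂ X
  core := tangentBundleCore 𝓘(ℂ) X
  hol := by
    have : IsManifold 𝓘(ℂ) (ω + 1) X := by simpa using ‹IsManifold 𝓘(ℂ) ω X›
    exact tangentBundleCore.isContMDiff

/-- The canonical bundle `K`, the dual of the holomorphic tangent bundle. -/
def canonical (X : Type u) [TopologicalSpace X] [ChartedSpace ℂ X] [IsManifold 𝓘(ℂ) ω X] :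
    HolLine X := (tangent X).dual

/-! ### Divisors of sections, degree, semistability -/

/-- The section `s` near `x`, in the distinguished trivialisation and the distinguished coordinate
around `x`. -/
def germ (L : HolLine X) (s : X → ℂ) (x : X) (z : ℂ) : ℂ :=
  L.localRep s (L.core.indexAt x) ((chartAt ℂ x).symm z)

/-- The order of vanishing at `x` of a holomorphic section `s`. -/
def vanishingOrder (L : HolLine X) (s : X → ℂ) (x : X) : ℕ∞ :=
  analyticOrderAt (L.germ s x) (chartAt ℂ x x)

/-- `s` is a meromorphic section of `L`, not identically zero, with divisor `D` (values of `s` at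
its poles are irrelevant). -/
def IsMeromorphicWithDivisor (L : HolLine X) (s : X → ℂ) (D : X →₀ ℤ) : Prop :=
  ∀ x, MeromorphicAt (L.germ s x) (chartAt ℂ x x) ∧
    meromorphicOrderAt (L.germ s x) (chartAt ℂ x x) = ((D x : ℤ) : WithTop ℤ)

/-- `deg L = d`: the line bundle `L` has nonzero meromorphic sections, and their divisors (which
all have the same degree when `X` is compact and connected) have degree `d`. -/
def HasDegree (L : HolLine X) (d : ℤ) : Prop :=
  (∃ s D, L.IsMeromorphicWithDivisor s D) ∧
    ∀ s D, L.IsMeromorphicWithDivisor s D → (D.sum fun _ n => n) = d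

/-- A rank two bundle is semistable if every line subbundle `M` satisfies
`deg M ≤ deg E / 2`. -/
def IsSemistable (E : HolVec X 2) : Prop :=
  ∀ (M : HolLine X) (f : M.Map E), (∀ x, Function.Injective (f.fib x)) →
    ∀ d e : ℤ, M.HasDegree d → E.det.HasDegree e → 2 * d ≤ e

end HolBundle

/-- The genus of a compact Riemann surface: the dimension of the space of holomorphic one-forms. -/
def genus (X : Type u) [TopologicalSpace X] [ChartedSpace ℂ X] [IsManifold 𝓘(ℂ) ω X] : ℕ :=
  Module.finrank ℂ (HolBundle.canonical X).H0

/-! ### Real structures and conjugate pullback -/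

/-- A real structure on a Riemann surface: an antiholomorphic involution. -/
structure RealStructure (X : Type u) [TopologicalSpace X] [ChartedSpace ℂ X] where
  /-- the involution -/
  toFun : X → X
  involutive : Function.Involutive toFun
  continuous : Continuous toFun
  /-- in local coordinates, the complex conjugate of the involution is holomorphic -/
  antiholomorphic : ∀ x, AnalyticAt ℂ
    (fun z => conj (chartAt ℂ (toFun x) (toFun ((chartAt ℂ x).symm z)))) (chartAt ℂ x x)

theorem analyticAt_star_conj [StarAddMonoid F] [StarModule ℂ F] [ContinuousStar F]
    [CompleteSpace F] {g : ℂ → F} {w : ℂ} (hg : AnalyticAt ℂ g w) :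
    AnalyticAt ℂ (fun z => star (g (conj z))) (conj w) := by
  rw [Complex.analyticAt_iff_eventually_differentiableAt] at hg ⊢
  have hc : Filter.Tendsto (fun z : ℂ => conj z) (𝓝 (conj w)) (𝓝 w) := by
    have := (Complex.continuous_conj.tendsto (conj w))
    simpa using this
  filter_upwards [hc.eventually hg] with z hz
  have := hz.star_conj
  simpa [Function.comp_def] using this

/-- If `f` is holomorphic on `U`, then `x ↦ star (f (τ x))` is holomorphic on `τ⁻¹ U`. -/
theorem RealStructure.contMDiffOn_star_comp [IsManifold 𝓘(ℂ) ω X] [StarAddMonoid F]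
    [StarModule ℂ F] [ContinuousStar F] [CompleteSpace F] (τ : RealStructure X) {f : X → F}
    {U : Set X} (hU : IsOpen U) (hf : ContMDiffOn 𝓘(ℂ) 𝓘(ℂ, F) ω f U) :
    ContMDiffOn 𝓘(ℂ) 𝓘(ℂ, F) ω (fun x => star (f (τ.toFun x))) (τ.toFun ⁻¹' U) := by
  intro x hx
  apply ContMDiffAt.contMDiffWithinAt
  have hfx : ContMDiffAt 𝓘(ℂ) 𝓘(ℂ, F) ω f (τ.toFun x) := hf.contMDiffAt (hU.mem_nhds hx)
  rw [contMDiffAt_iff] at hfx ⊢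
  refine ⟨(continuous_star.continuousAt).comp
    (ContinuousAt.comp (f := τ.toFun) hfx.1 τ.continuous.continuousAt), ?_⟩
  have h2 := hfx.2
  simp only [mfld_simps, chartAt_self_eq] at h2 ⊢
  rw [contDiffWithinAt_univ] at h2 ⊢
  have h3 : AnalyticAt ℂ (f ∘ (chartAt ℂ (τ.toFun x)).symm)
      (chartAt ℂ (τ.toFun x) (τ.toFun x)) := by
    simpa using h2.analyticAt
  have h4 := analyticAt_star_conj h3
  have h5 := τ.antiholomorphic x
  have h6 : AnalyticAt ℂ ((fun z => star ((f ∘ (chartAt ℂ (τ.toFun x)).symm) (conj z))) ∘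
      (fun z => conj (chartAt ℂ (τ.toFun x) (τ.toFun ((chartAt ℂ x).symm z)))))
      (chartAt ℂ x x) := by
    refine AnalyticAt.comp ?_ h5
    simpa using h4
  refine AnalyticAt.contDiffAt (h6.congr ?_)
  have hev : ∀ᶠ z in 𝓝 (chartAt ℂ x x),
      τ.toFun ((chartAt ℂ x).symm z) ∈ (chartAt ℂ (τ.toFun x)).source := by
    have hcont : ContinuousAt (fun z => τ.toFun ((chartAt ℂ x).symm z)) (chartAt ℂ x x) :=
      τ.continuous.continuousAt.comp
        ((chartAt ℂ x).continuousAt_symm (mem_chart_target ℂ x))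
    refine hcont.preimage_mem_nhds ?_
    simpa using (chartAt ℂ (τ.toFun x)).open_source.mem_nhds (mem_chart_source ℂ _)
  filter_upwards [hev] with z hz
  simp [(chartAt ℂ (τ.toFun x)).left_inv hz]

theorem contMDiffOn_clm_of_apply [FiniteDimensional ℂ F] {f : X → F →L[ℂ] F} {U : Set X}
    (h : ∀ v, ContMDiffOn 𝓘(ℂ) 𝓘(ℂ, F) ω (fun x => f x v) U) :
    ContMDiffOn 𝓘(ℂ) 𝓘(ℂ, F →L[ℂ] F) ω f U := by
  let b := Module.finBasis ℂ F
  have hf : f = fun x => ∑ k, ContinuousLinearMap.smulRightL ℂ F F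
      (LinearMap.toContinuousLinearMap (b.coord k)) (f x (b k)) := by
    funext x
    ext1 v
    have h1 : f x v = ∑ k, b.repr v k • f x (b k) := by
      conv_lhs => rw [← b.sum_repr v]
      simp only [map_sum, map_smul]
    simpa using h1
  rw [hf]
  refine contMDiffOn_finsetSum fun k _ => ?_
  exact (ContinuousLinearMap.contMDiff _).comp_contMDiffOn (h (b k))

section Conj

variable [StarAddMonoid F] [StarModule ℂ F] [ContinuousStar F]

/-- The complex conjugate `v ↦ star (A (star v))` of a linear map `A`. -/
def conjCLM (A : F →L[ℂ] F) : F →L[ℂ] F :=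
  ((starL ℂ : F ≃L⋆[ℂ] F) : F →L⋆[ℂ] F).comp
    (A.comp ((starL ℂ : F ≃L⋆[ℂ] F) : F →L⋆[ℂ] F))

theorem conjCLM_apply (A : F →L[ℂ] F) (v : F) : conjCLM A v = star (A (star v)) := rfl

variable [FiniteDimensional ℂ F]

/-- The bundle `τ^*(Ē)`: its fibre over `x` is the complex conjugate of `E_{τ x}`. -/
def HolBundle.conjPullback [IsManifold 𝓘(ℂ) ω X] (E : HolBundle X F) (τ : RealStructure X) :
    HolBundle X F :=
  have key : ∀ i j : E.ι, ContMDiffOn 𝓘(ℂ) 𝓘(ℂ, F →L[ℂ] F) ω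
      (fun x => conjCLM (E.core.coordChange i j (τ.toFun x)))
      (τ.toFun ⁻¹' E.core.baseSet i ∩ τ.toFun ⁻¹' E.core.baseSet j) := fun i j =>
    have : CompleteSpace F := FiniteDimensional.complete ℂ F
    contMDiffOn_clm_of_apply fun v => τ.contMDiffOn_star_comp
      ((E.core.isOpen_baseSet i).inter (E.core.isOpen_baseSet j))
      ((E.contMDiffOn_coordChange i j).clm_apply (contMDiffOn_const (c := star v)))
  { ι := E.ι
    core :=
      { baseSet := fun i => τ.toFun ⁻¹' E.core.baseSet i
        isOpen_baseSet := fun i => (E.core.isOpen_baseSet i).preimage τ.continuous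
        indexAt := fun x => E.core.indexAt (τ.toFun x)
        mem_baseSet_at := fun x => E.core.mem_baseSet_at (τ.toFun x)
        coordChange := fun i j x => conjCLM (E.core.coordChange i j (τ.toFun x))
        coordChange_self := fun i x hx v => by
          rw [conjCLM_apply, E.core.coordChange_self i _ hx, star_star]
        continuousOn_coordChange := fun i j => (key i j).continuousOn
        coordChange_comp := fun i j k x hx v => by
          rw [conjCLM_apply, conjCLM_apply, conjCLM_apply, star_star,
            E.core.coordChange_comp i j k _ hx] }
    hol := ⟨key⟩ }

/-- A bundle is real if `τ^*(Ē) ≅ E`. -/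
def HolBundle.IsReal [IsManifold 𝓘(ℂ) ω X] (E : HolBundle X F) (τ : RealStructure X) : Prop :=
  (E.conjPullback τ).Isom E

end Conj

/-! ### Extensions, their Čech classes and the associated divisor -/

/-- An extension `0 → L → E → Q → 0` of holomorphic bundles. -/
structure Extension (L : HolLine X) (E : HolVec X 2) (Q : HolLine X) where
  inc : L.Map E
  proj : E.Map Q
  inc_injective : ∀ x, Function.Injective (inc.fib x)
  proj_surjective : ∀ x, Function.Surjective (proj.fib x)
  exact : ∀ x, Function.Exact (inc.fib x) (proj.fib x)

/-- An open cover of `X`. -/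
structure OpenCover (X : Type u) [TopologicalSpace X] where
  /-- the index set -/
  α : Type u
  /-- the open sets -/
  V : α → Set X
  isOpen : ∀ a, IsOpen (V a)
  covers : ∀ x, ∃ a, x ∈ V a

/-- A Čech `1`-cocycle of holomorphic sections of the line bundle `L`. -/
structure CechCocycle (𝒱 : OpenCover X) (L : HolLine X) where
  /-- the section over `V a ∩ V b` -/
  c : 𝒱.α → 𝒱.α → X → ℂ
  hol : ∀ a b, L.IsHolSectionOn (𝒱.V a ∩ 𝒱.V b) (c a b)
  cocycle : ∀ a b d, ∀ x ∈ 𝒱.V a ∩ 𝒱.V b ∩ 𝒱.V d, c a b x + c b d x = c a d x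

/-- The `1`-cochain `c` of the line bundle `L` is a coboundary. For a cocycle this says that its
class in `H¹(X, L)` vanishes, as `H¹(𝒱, L) → H¹(X, L)` is injective. -/
def IsCoboundary (𝒱 : OpenCover X) (L : HolLine X) (c : 𝒱.α → 𝒱.α → X → ℂ) : Prop :=
  ∃ k : 𝒱.α → X → ℂ, (∀ a, L.IsHolSectionOn (𝒱.V a) (k a)) ∧
    ∀ a b, ∀ x ∈ 𝒱.V a ∩ 𝒱.V b, c a b x = k b x - k a x

namespace Extension

variable {L Q : HolLine X} {E : HolVec X 2}

/-- The cocycle `c` of `Hom(Q, L) = Q⁻¹ ⊗ L` represents the extension class in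
`H¹(X, Hom(Q, L)) = Ext¹(Q, L)`: it is the difference `σ_b - σ_a` of local holomorphic splittings
`σ_a : Q → E` of the extension over the members of the cover. -/
def IsRepresentedBy (S : Extension L E Q) {𝒱 : OpenCover X} (c : CechCocycle 𝒱 (Q.dual.tensor L)) :
    Prop :=
  ∃ σ : 𝒱.α → X → ℂ →L[ℂ] (Fin 2 → ℂ),
    (∀ a, Q.IsHolMapOn E (𝒱.V a) (σ a)) ∧
    (∀ a, ∀ x ∈ 𝒱.V a, ∀ q, S.proj.fib x (σ a x q) = q) ∧
    ∀ a b, ∀ x ∈ 𝒱.V a ∩ 𝒱.V b, ∀ q, σ b x q - σ a x q = S.inc.fib x (c.c a b x * q)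

variable [IsManifold 𝓘(ℂ) ω X]

/-- The line bundle `Hom(L, Q) ⊗ K`, the Serre dual of `Hom(Q, L)`; it is `L⁻² ⊗ Λ ⊗ K` for
`Q = L⁻¹ ⊗ Λ`. -/
def serreDualLine (L Q : HolLine X) : HolLine X :=
  (L.dual.tensor Q).tensor (HolBundle.canonical X)

/-- The section `s` of `Hom(L, Q) ⊗ K` is annihilated by the extension class `e` under the Serre
duality pairing `H⁰(Hom(L, Q) ⊗ K) × H¹(Hom(Q, L)) → H¹(K) ≅ ℂ`: the cup product `s · e`
vanishes in `H¹(K)`. -/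
def Annihilates (S : Extension L E Q) (s : X → ℂ) : Prop :=
  ∃ (𝒱 : OpenCover X) (c : CechCocycle 𝒱 (Q.dual.tensor L)), S.IsRepresentedBy c ∧
    IsCoboundary 𝒱 (HolBundle.canonical X) fun a b x => s x * c.c a b x

open Classical in
/-- `D ∈ Sym³(X)` is the divisor associated with the extension: the sections of `Hom(L, Q) ⊗ K`
annihilated by the extension class form a line `ℂ s`, and `D` is the divisor of zeros of `s`. -/
def IsAssociatedDivisor (S : Extension L E Q) (D : Sym X 3) : Prop :=
  ∃ s ∈ (serreDualLine L Q).H0,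
    (∀ t ∈ (serreDualLine L Q).H0, S.Annihilates t ↔ ∃ z : ℂ, t = z • s) ∧
    ∀ x, (serreDualLine L Q).vanishingOrder s x = ((D : Multiset X).count x : ℕ∞)

end Extension

end RealCurve

end

open RealCurve

/-!
All bundles live in fibre coordinates: a section of a line bundle is a function `X → ℂ`, a bundle
map is a family of linear maps between typical fibres, and tensor products, duals and conjugates
change only what it means to be holomorphic. Holomorphy at `x` is read in the distinguished frames around
`x` (`HolMapAt`, and `HolScAt` for scalar maps between line bundles).

Write `Q = L⁻¹ ⊗ Λ`. Since `E` is semistable of degree one and `deg Q = 1`, the extension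
`0 → L → E → Q → 0` does not split (`Extension.not_splits`); this is the only use of semistability.
A section `s : L → Q ⊗ K` is annihilated by the extension class exactly when it extends to a map
`φ : E → Q ⊗ K` (`Annihilates.exists_map`, `annihilates_of_map`), which replaces Serre duality by
an elementary statement about maps.

If `L` is real, conjugation gives a second embedding of `L` in `E`. It is a multiple of the first
one (`Extension.exists_eq_smul_inc`), because otherwise the extension would split. So the conjugate
of `φ` shows that the conjugate of `s` is annihilated too. It is therefore a multiple of `s`, and
the divisor is real (`count_eq_of_isReal`).

If `D` is real, `s` and its conjugate have the same zeros, and their ratio identifies `L ⊗ L` with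
`L' ⊗ L'`, where `L'` is the conjugate of `L`. Put `L₀ = L'⁻¹ ⊗ L`, a square root of the trivial
bundle. The conjugate extension twisted by `L₀` has middle term `L₀ ⊗ E`, the same ends `L` and `Q`,
and annihilates the same `s`. The comparison theorem `Extension.isom_of_annihilates` then gives
`L₀ ⊗ E ≅ E`, and genericity makes `L₀` trivial (`isReal_of_count_eq`).

The comparison theorem is linear algebra. The pair of the projection and `φ` embeds `E` in
`Q ⊕ Q ⊗ K` off the zeros of `s`, so that `E` is determined by the class of `φ ∘ σ` modulo `s`, for
`σ` a local splitting. This class lies in the space of sections of `K` over the divisor, of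
dimension three. The space `H⁰(K)` embeds in it as a plane, since `deg L < deg Q`, and the class
does not lie in the plane, since the extension does not split. Hence the classes of two such extensions are
proportional modulo the plane, which provides an isomorphism off the zeros of `s`, and local
division by `s` together with the gluing lemma `HolBundle.exists_holMapAt_of_local` extends it.
-/

noncomputable section

namespace RealCurve

variable {X : Type u} [TopologicalSpace X] [ChartedSpace ℂ X]
  {G : Type*} [NormedAddCommGroup G] [NormedSpace ℂ G]
  {F : Type} [NormedAddCommGroup F] [NormedSpace ℂ F]
  {F' : Type} [NormedAddCommGroup F'] [NormedSpace ℂ F']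

/-! ### Germs of holomorphic functions on a Riemann surface -/

/-- `f` is holomorphic at `x`. -/
abbrev HolAt (f : X → G) (x : X) : Prop := ContMDiffAt 𝓘(ℂ) 𝓘(ℂ, G) ω f x

/-- The order of vanishing at `x` of `f`, computed in the distinguished chart around `x`; it is `⊤`
when `f` vanishes identically near `x`. -/
def ordAt (f : X → G) (x : X) : ℕ∞ := analyticOrderAt (f ∘ (chartAt ℂ x).symm) (chartAt ℂ x x)

theorem eventually_chart {x : X} {p : X → Prop} :
    (∀ᶠ z in 𝓝 (chartAt ℂ x x), p ((chartAt ℂ x).symm z)) ↔ ∀ᶠ y in 𝓝 x, p y :=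
  (chartAt ℂ x).eventually_nhds' p (mem_chart_source ℂ x)

theorem eventually_mem_chart_source (x : X) : ∀ᶠ y in 𝓝 x, y ∈ (chartAt ℂ x).source :=
  (chartAt ℂ x).open_source.mem_nhds (mem_chart_source ℂ x)

theorem eventually_mem_chart_target (x : X) :
    ∀ᶠ z in 𝓝 (chartAt ℂ x x), z ∈ (chartAt ℂ x).target :=
  (chartAt ℂ x).open_target.mem_nhds (mem_chart_target ℂ x)

theorem eventually_chart_ne {x : X} {p : X → Prop} :
    (∀ᶠ z in 𝓝[≠] (chartAt ℂ x x), p ((chartAt ℂ x).symm z)) ↔ ∀ᶠ y in 𝓝[≠] x, p y := by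
  rw [eventually_nhdsWithin_iff, eventually_nhdsWithin_iff, ← eventually_chart (x := x)]
  refine Filter.eventually_congr ?_
  filter_upwards [eventually_mem_chart_target x] with z hz
  have : z = chartAt ℂ x x ↔ (chartAt ℂ x).symm z = x := by
    constructor
    · rintro rfl; exact (chartAt ℂ x).left_inv (mem_chart_source ℂ x)
    · intro h; rw [← (chartAt ℂ x).right_inv hz, h]
  simp [this]

theorem nhdsNE_neBot_of_chart (x : X) : (𝓝[≠] x).NeBot := by
  refine ⟨fun h => ?_⟩
  have h1 : ∀ᶠ y in 𝓝[≠] x, False := by rw [h]; exact Filter.eventually_bot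
  rw [← eventually_chart_ne (p := fun _ => False)] at h1
  exact h1.exists.elim fun _ h => h

theorem holAt_iff_analyticAt [CompleteSpace G] {f : X → G} {x : X} :
    HolAt f x ↔ AnalyticAt ℂ (f ∘ (chartAt ℂ x).symm) (chartAt ℂ x x) := by
  rw [HolAt, contMDiffAt_iff]
  simp only [mfld_simps, chartAt_self_eq]
  rw [contDiffWithinAt_univ]
  refine ⟨fun h => ContDiffAt.analyticAt h.2, fun h => ⟨?_, h.contDiffAt⟩⟩
  have h1 : ContinuousAt ((f ∘ (chartAt ℂ x).symm) ∘ chartAt ℂ x) x :=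
    ContinuousAt.comp h.continuousAt ((chartAt ℂ x).continuousAt (mem_chart_source ℂ x))
  refine h1.congr ?_
  filter_upwards [eventually_mem_chart_source x] with y hy
  simp [(chartAt ℂ x).left_inv hy]

theorem holAt_const {c : G} {x : X} : HolAt (fun _ : X => c) x := contMDiffAt_const

theorem HolAt.comp_chart [CompleteSpace G] {h : ℂ → G} {x : X}
    (hh : AnalyticAt ℂ h (chartAt ℂ x x)) :
    HolAt (fun y => h (chartAt ℂ x y)) x := by
  rw [holAt_iff_analyticAt]
  refine hh.congr ?_
  filter_upwards [eventually_mem_chart_target x] with z hz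
  simp [(chartAt ℂ x).right_inv hz]

theorem ordAt_congr {f g : X → G} {x : X} (h : f =ᶠ[𝓝 x] g) : ordAt f x = ordAt g x :=
  analyticOrderAt_congr (eventually_chart.2 h)

theorem ordAt_eq_top {f : X → G} {x : X} : ordAt f x = ⊤ ↔ ∀ᶠ y in 𝓝 x, f y = 0 := by
  rw [ordAt, analyticOrderAt_eq_top]
  exact eventually_chart (p := fun y => f y = 0)

theorem HolAt.ordAt_eq_zero [CompleteSpace G] {f : X → G} {x : X} (hf : HolAt f x) :
    ordAt f x = 0 ↔ f x ≠ 0 := by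
  rw [ordAt, (holAt_iff_analyticAt.1 hf).analyticOrderAt_eq_zero]
  simp [(chartAt ℂ x).left_inv (mem_chart_source ℂ x)]

theorem ordAt_mul {f g : X → ℂ} {x : X} (hf : HolAt f x) (hg : HolAt g x) :
    ordAt (fun y => f y * g y) x = ordAt f x + ordAt g x :=
  analyticOrderAt_mul (holAt_iff_analyticAt.1 hf) (holAt_iff_analyticAt.1 hg)

theorem HolAt.eventually_eq_zero_or_ne_zero [CompleteSpace G] {f : X → G} {x : X} (hf : HolAt f x) :
    (∀ᶠ y in 𝓝 x, f y = 0) ∨ ∀ᶠ y in 𝓝[≠] x, f y ≠ 0 := by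
  rcases (holAt_iff_analyticAt.1 hf).eventually_eq_zero_or_eventually_ne_zero with h | h
  · exact Or.inl (eventually_chart.1 h)
  · exact Or.inr (eventually_chart_ne (p := fun y => f y ≠ 0).1 h)

theorem HolAt.eventually_ne_zero [CompleteSpace G] {f : X → G} {x : X} (hf : HolAt f x)
    (h : ordAt f x ≠ ⊤) :
    ∀ᶠ y in 𝓝[≠] x, f y ≠ 0 :=
  hf.eventually_eq_zero_or_ne_zero.resolve_left fun h' => h (ordAt_eq_top.2 h')

/-- Local division: a holomorphic germ is a multiple of any scalar germ whose order is finite and does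
not exceed its own. -/
theorem exists_local_quotient [CompleteSpace G] {r : X → ℂ} {g : X → G} {x : X}
    (hr : HolAt r x) (hg : HolAt g x) (htop : ordAt r x ≠ ⊤) (hle : ordAt r x ≤ ordAt g x) :
    ∃ h : X → G, HolAt h x ∧ ∀ᶠ y in 𝓝 x, r y • h y = g y := by
  have hr' := holAt_iff_analyticAt.1 hr
  have hg' := holAt_iff_analyticAt.1 hg
  obtain ⟨n, hn⟩ := ENat.ne_top_iff_exists.1 htop
  obtain ⟨u, hu, hu0, hru⟩ := hr'.analyticOrderAt_eq_natCast.1 hn.symm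
  rw [← hn] at hle
  obtain ⟨v, hv, hgv⟩ := (natCast_le_analyticOrderAt hg').1 hle
  refine ⟨fun y => (u (chartAt ℂ x y))⁻¹ • v (chartAt ℂ x y),
    HolAt.comp_chart (h := fun z => (u z)⁻¹ • v z) ((hu.inv hu0).smul hv), ?_⟩
  rw [← eventually_chart]
  filter_upwards [hru, hgv, eventually_mem_chart_target x, hu.continuousAt.eventually_ne hu0]
    with z h1 h2 h3 h4
  simp only [Function.comp_apply] at h1 h2
  rw [h1, h2, (chartAt ℂ x).right_inv h3, smul_smul, smul_eq_mul, mul_assoc, mul_inv_cancel₀ h4,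
    mul_one]

/-- Holomorphic functions that agree on a punctured neighbourhood agree at the puncture. -/
theorem eq_of_eventually_nhdsNE {f g : X → G} {x : X} (hf : HolAt f x) (hg : HolAt g x)
    (h : ∀ᶠ y in 𝓝[≠] x, f y = g y) : f x = g x := by
  have := nhdsNE_neBot_of_chart x
  have h1 : Filter.Tendsto f (𝓝[≠] x) (𝓝 (f x)) := hf.continuousAt.mono_left nhdsWithin_le_nhds
  have h2 : Filter.Tendsto g (𝓝[≠] x) (𝓝 (g x)) := hg.continuousAt.mono_left nhdsWithin_le_nhds
  exact tendsto_nhds_unique (h1.congr' h) h2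

/-! ### Jets -/

/-- The `j`-th derivative of `f` at `x` in the distinguished chart. -/
def jet (j : ℕ) (f : X → ℂ) (x : X) : ℂ :=
  iteratedDeriv j (f ∘ (chartAt ℂ x).symm) (chartAt ℂ x x)

theorem natCast_le_ordAt_iff_jet {f : X → ℂ} {x : X} (hf : HolAt f x) {n : ℕ} :
    n ≤ ordAt f x ↔ ∀ j < n, jet j f x = 0 :=
  natCast_le_analyticOrderAt_iff_iteratedDeriv_eq_zero (holAt_iff_analyticAt.1 hf)

theorem jet_add {f g : X → ℂ} {x : X} (hf : HolAt f x) (hg : HolAt g x) (j : ℕ) :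
    jet j (fun y => f y + g y) x = jet j f x + jet j g x :=
  iteratedDeriv_fun_add (holAt_iff_analyticAt.1 hf).contDiffAt
    (holAt_iff_analyticAt.1 hg).contDiffAt

theorem jet_const_mul {f : X → ℂ} {x : X} (hf : HolAt f x) (c : ℂ) (j : ℕ) :
    jet j (fun y => c * f y) x = c * jet j f x :=
  iteratedDeriv_const_mul c (holAt_iff_analyticAt.1 hf).contDiffAt

/-! ### Conjugation by a real structure -/

namespace RealStructure

variable (τ : RealStructure X)

theorem tendsto (x : X) : Filter.Tendsto τ.toFun (𝓝 x) (𝓝 (τ.toFun x)) :=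
  τ.continuous.continuousAt

theorem apply_apply (x : X) : τ.toFun (τ.toFun x) = x := τ.involutive x

/-- The involution in the distinguished coordinates around `x` and `τ x`, conjugated. -/
def coord (x : X) (z : ℂ) : ℂ := conj (chartAt ℂ (τ.toFun x) (τ.toFun ((chartAt ℂ x).symm z)))

theorem analyticAt_coord (x : X) : AnalyticAt ℂ (τ.coord x) (chartAt ℂ x x) := τ.antiholomorphic x

theorem coord_self (x : X) :
    τ.coord x (chartAt ℂ x x) = conj (chartAt ℂ (τ.toFun x) (τ.toFun x)) := by
  simp [coord, (chartAt ℂ x).left_inv (mem_chart_source ℂ x)]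

theorem conj_coord_coord (x : X) :
    ∀ᶠ z in 𝓝 (chartAt ℂ x x), conj (τ.coord (τ.toFun x) (conj (τ.coord x z))) = z := by
  have h1 : ∀ᶠ y in 𝓝 x, τ.toFun y ∈ (chartAt ℂ (τ.toFun x)).source :=
    (τ.tendsto x).eventually (eventually_mem_chart_source _)
  filter_upwards [eventually_chart.2 h1, eventually_mem_chart_target x] with z hz hz'
  simp only [coord, Complex.conj_conj]
  rw [(chartAt ℂ (τ.toFun x)).left_inv hz, τ.apply_apply, τ.apply_apply,
    (chartAt ℂ x).right_inv hz']

theorem deriv_coord_ne_zero (x : X) : deriv (τ.coord x) (chartAt ℂ x x) ≠ 0 := by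
  have h1 : AnalyticAt ℂ (fun z => conj (τ.coord (τ.toFun x) (conj z)))
      (τ.coord x (chartAt ℂ x x)) := by
    rw [coord_self]
    exact analyticAt_star_conj (τ.analyticAt_coord (τ.toFun x))
  have h2 : HasDerivAt (fun z => conj (τ.coord (τ.toFun x) (conj (τ.coord x z))))
      (deriv (fun z => conj (τ.coord (τ.toFun x) (conj z))) (τ.coord x (chartAt ℂ x x)) *
        deriv (τ.coord x) (chartAt ℂ x x)) (chartAt ℂ x x) :=
    HasDerivAt.comp (h₂ := fun z => conj (τ.coord (τ.toFun x) (conj z))) _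
      h1.differentiableAt.hasDerivAt (τ.analyticAt_coord x).differentiableAt.hasDerivAt
  have h3 := h2.unique
    ((hasDerivAt_id (chartAt ℂ x x)).congr_of_eventuallyEq (τ.conj_coord_coord x))
  intro h
  simp [h] at h3

theorem eventually_comp {x : X} {p : X → Prop} (h : ∀ᶠ y in 𝓝 (τ.toFun x), p y) :
    ∀ᶠ y in 𝓝 x, p (τ.toFun y) := (τ.tendsto x).eventually h

theorem comp_chart_symm_eventuallyEq {T : Type*} {f : X → T} (x : X) :
    (fun z => f (τ.toFun ((chartAt ℂ x).symm z))) =ᶠ[𝓝 (chartAt ℂ x x)]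
      fun z => (f ∘ (chartAt ℂ (τ.toFun x)).symm) (conj (τ.coord x z)) := by
  have h1 : ∀ᶠ y in 𝓝 x, τ.toFun y ∈ (chartAt ℂ (τ.toFun x)).source :=
    (τ.tendsto x).eventually (eventually_mem_chart_source _)
  filter_upwards [eventually_chart.2 h1] with z hz
  simp [coord, (chartAt ℂ (τ.toFun x)).left_inv hz]

theorem holAt_star_comp [CompleteSpace F] [StarAddMonoid F] [StarModule ℂ F]
    [ContinuousStar F] {f : X → F} {x : X} (hf : HolAt f (τ.toFun x)) :
    HolAt (fun y => star (f (τ.toFun y))) x := by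
  rw [holAt_iff_analyticAt] at hf ⊢
  have h1 := analyticAt_star_conj hf
  rw [← τ.coord_self] at h1
  refine (h1.comp (τ.analyticAt_coord x)).congr ?_
  filter_upwards [τ.comp_chart_symm_eventuallyEq (f := f) x] with z hz
  simp only [Function.comp_apply] at hz ⊢
  rw [hz]

theorem holAt_conj_clm_comp [FiniteDimensional ℂ F] [Star F]
    [CompleteSpace F'] [StarAddMonoid F'] [StarModule ℂ F'] [ContinuousStar F']
    {f : X → F →L[ℂ] F'} {x : X} (hf : HolAt f (τ.toFun x)) {g : X → F →L[ℂ] F'}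
    (hg : ∀ y v, g y v = star (f (τ.toFun y) (star v))) : HolAt g x := by
  let b := Module.finBasis ℂ F
  have hg' : g = fun y => ∑ k, ContinuousLinearMap.smulRightL ℂ F F'
      (LinearMap.toContinuousLinearMap (b.coord k)) (g y (b k)) := by
    funext x
    ext1 v
    have h1 : g x v = ∑ k, b.repr v k • g x (b k) := by
      conv_lhs => rw [← b.sum_repr v]
      simp only [map_sum, map_smul]
    simpa using h1
  rw [hg']
  refine contMDiffAt_finsetSum fun k _ => ?_
  refine (ContinuousLinearMap.contMDiff _).contMDiffAt.comp x ?_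
  simp only [hg]
  exact τ.holAt_star_comp (hf.clm_apply contMDiffAt_const)

theorem ordAt_conj_comp {f : X → ℂ} {x : X} (hf : HolAt f (τ.toFun x)) :
    ordAt (fun y => conj (f (τ.toFun y))) x = ordAt f (τ.toFun x) := by
  have key : ∀ w : ℂ, ∀ S : ℂ → ℂ, AnalyticAt ℂ S w →
      analyticOrderAt (fun z => conj (S (conj z))) (conj w) = analyticOrderAt S w := by
    intro w S hS
    have hc : Filter.Tendsto (fun z : ℂ => conj z) (𝓝 (conj w)) (𝓝 w) := by
      simpa using Complex.continuous_conj.tendsto (conj w)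
    have hS' : AnalyticAt ℂ (fun z => conj (S (conj z))) (conj w) := analyticAt_star_conj hS
    rcases eq_or_ne (analyticOrderAt S w) ⊤ with h | h
    · rw [h, analyticOrderAt_eq_top]
      rw [analyticOrderAt_eq_top] at h
      filter_upwards [hc.eventually h] with z hz
      simp [hz]
    · obtain ⟨n, hn⟩ := ENat.ne_top_iff_exists.1 h
      obtain ⟨u, hu, hu0, hru⟩ := hS.analyticOrderAt_eq_natCast.1 hn.symm
      rw [← hn, hS'.analyticOrderAt_eq_natCast]
      refine ⟨fun z => conj (u (conj z)), analyticAt_star_conj hu, by simpa using hu0, ?_⟩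
      filter_upwards [hc.eventually hru] with z hz
      simp [hz]
  have h1 := key _ _ (holAt_iff_analyticAt.1 hf)
  rw [ordAt, ordAt, ← h1, ← τ.coord_self,
    ← analyticOrderAt_comp_of_deriv_ne_zero (τ.analyticAt_coord x) (τ.deriv_coord_ne_zero x)]
  refine analyticOrderAt_congr ?_
  filter_upwards [τ.comp_chart_symm_eventuallyEq (f := f) x] with z hz
  simp only [Function.comp_apply] at hz ⊢
  rw [hz]

end RealStructure

end RealCurve

namespace RealCurve

variable {X : Type u} [TopologicalSpace X] [ChartedSpace ℂ X]
  {F : Type} [NormedAddCommGroup F] [NormedSpace ℂ F]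
  {F' : Type} [NormedAddCommGroup F'] [NormedSpace ℂ F']
  {F'' : Type} [NormedAddCommGroup F''] [NormedSpace ℂ F'']

namespace HolBundle

/-! ### Holomorphic bundle maps in local frames -/

/-- The distinguished frame around `x`, as a map from the typical fibre to the fibre over `y`. It is
invertible for `y` near `x`. -/
def frame (E : HolBundle X F) (x y : X) : F →L[ℂ] F :=
  E.core.coordChange (E.core.indexAt x) (E.core.indexAt y) y

/-- The inverse of the distinguished frame around `x`, for `y` near `x`. -/
def coframe (E : HolBundle X F) (x y : X) : F →L[ℂ] F :=
  E.core.coordChange (E.core.indexAt y) (E.core.indexAt x) y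

/-- The family `φ` of maps between the fibres of `E` and `E'`, read in the distinguished frames
around `x`. -/
def readMap (E : HolBundle X F) (E' : HolBundle X F') (φ : X → F →L[ℂ] F') (x y : X) :
    F →L[ℂ] F' :=
  (E'.coframe x y).comp ((φ y).comp (E.frame x y))

/-- The family of fibre maps with prescribed reading `H` in the distinguished frames around `x`. -/
def unreadMap (E : HolBundle X F) (E' : HolBundle X F') (H : X → F →L[ℂ] F') (x y : X) :
    F →L[ℂ] F' :=
  (E'.frame x y).comp ((H y).comp (E.coframe x y))

/-- The family `φ` of fibre maps is a holomorphic bundle map `E → E'` near `x`. -/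
def HolMapAt (E : HolBundle X F) (E' : HolBundle X F') (φ : X → F →L[ℂ] F') (x : X) : Prop :=
  HolAt (E.readMap E' φ x) x

variable {E : HolBundle X F} {E' : HolBundle X F'} {E'' : HolBundle X F''}

theorem eventually_mem_baseSet (E : HolBundle X F) (x : X) :
    ∀ᶠ y in 𝓝 x, y ∈ E.core.baseSet (E.core.indexAt x) :=
  (E.core.isOpen_baseSet _).mem_nhds (E.core.mem_baseSet_at x)

theorem coordChange_coordChange (E : HolBundle X F) {i j k : E.ι} {y : X}
    (hi : y ∈ E.core.baseSet i) (hj : y ∈ E.core.baseSet j) (hk : y ∈ E.core.baseSet k) (v : F) :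
    E.core.coordChange j k y (E.core.coordChange i j y v) = E.core.coordChange i k y v :=
  E.core.coordChange_comp i j k y ⟨⟨hi, hj⟩, hk⟩ v

theorem coordChange_coordChange_self (E : HolBundle X F) {i j : E.ι} {y : X}
    (hi : y ∈ E.core.baseSet i) (hj : y ∈ E.core.baseSet j) (v : F) :
    E.core.coordChange j i y (E.core.coordChange i j y v) = v := by
  rw [E.coordChange_coordChange hi hj hi, E.core.coordChange_self i y hi]

theorem eventually_coframe_frame (E : HolBundle X F) (x : X) :
    ∀ᶠ y in 𝓝 x, ∀ v, E.coframe x y (E.frame x y v) = v := by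
  filter_upwards [E.eventually_mem_baseSet x] with y hy v
  exact E.coordChange_coordChange_self hy (E.core.mem_baseSet_at y) v

theorem eventually_frame_coframe (E : HolBundle X F) (x : X) :
    ∀ᶠ y in 𝓝 x, ∀ v, E.frame x y (E.coframe x y v) = v := by
  filter_upwards [E.eventually_mem_baseSet x] with y hy v
  exact E.coordChange_coordChange_self (E.core.mem_baseSet_at y) hy v

theorem frame_self (E : HolBundle X F) (x : X) (v : F) : E.frame x x v = v :=
  E.core.coordChange_self _ x (E.core.mem_baseSet_at x) v

theorem coframe_self (E : HolBundle X F) (x : X) (v : F) : E.coframe x x v = v :=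
  E.core.coordChange_self _ x (E.core.mem_baseSet_at x) v

theorem readMap_self (φ : X → F →L[ℂ] F') (x : X) : E.readMap E' φ x x = φ x := by
  ext v
  simp [readMap, frame_self, coframe_self]

theorem isHolMapOn_iff {V : Set X} (hV : IsOpen V) {φ : X → F →L[ℂ] F'} :
    E.IsHolMapOn E' V φ ↔ ∀ x ∈ V, E.HolMapAt E' φ x := by
  constructor
  · intro h x hx
    have hmem : V ∩ (E.core.baseSet (E.core.indexAt x) ∩ E'.core.baseSet (E'.core.indexAt x)) ∈
        𝓝 x :=
      (hV.inter ((E.core.isOpen_baseSet _).inter (E'.core.isOpen_baseSet _))).mem_nhds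
        ⟨hx, E.core.mem_baseSet_at x, E'.core.mem_baseSet_at x⟩
    exact (h (E.core.indexAt x) (E'.core.indexAt x)).contMDiffAt hmem
  · intro h i j x hx
    have h1 : HolAt (E.core.coordChange i (E.core.indexAt x)) x :=
      (E.contMDiffOn_coordChange i _).contMDiffAt
        (((E.core.isOpen_baseSet _).inter (E.core.isOpen_baseSet _)).mem_nhds
          ⟨hx.2.1, E.core.mem_baseSet_at x⟩)
    have h2 : HolAt (E'.core.coordChange (E'.core.indexAt x) j) x :=
      (E'.contMDiffOn_coordChange _ j).contMDiffAt
        (((E'.core.isOpen_baseSet _).inter (E'.core.isOpen_baseSet _)).mem_nhds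
          ⟨E'.core.mem_baseSet_at x, hx.2.2⟩)
    refine (((h2.clm_comp (h x hx.1)).clm_comp h1).congr_of_eventuallyEq ?_).contMDiffWithinAt
    filter_upwards [E.eventually_mem_baseSet x, E'.eventually_mem_baseSet x,
      (E.core.isOpen_baseSet i).mem_nhds hx.2.1, (E'.core.isOpen_baseSet j).mem_nhds hx.2.2]
      with y hy hy' hi hj
    ext v
    simp only [readMap, frame, coframe, ContinuousLinearMap.comp_apply]
    rw [E.coordChange_coordChange hi hy (E.core.mem_baseSet_at y),
      E'.coordChange_coordChange (E'.core.mem_baseSet_at y) hy' hj]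

theorem Map.holMapAt (f : E.Map E') (x : X) : E.HolMapAt E' f.fib x :=
  (isHolMapOn_iff isOpen_univ).1 f.hol x trivial

/-- A family of fibre maps that is everywhere holomorphic, as a bundle map. -/
def Map.ofHolMapAt (φ : X → F →L[ℂ] F') (h : ∀ x, E.HolMapAt E' φ x) : E.Map E' :=
  ⟨φ, (isHolMapOn_iff isOpen_univ).2 fun x _ => h x⟩

theorem HolMapAt.congr {φ ψ : X → F →L[ℂ] F'} {x : X} (h : E.HolMapAt E' φ x)
    (hψ : ∀ᶠ y in 𝓝 x, ψ y = φ y) : E.HolMapAt E' ψ x := by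
  refine ContMDiffAt.congr_of_eventuallyEq h ?_
  filter_upwards [hψ] with y hy
  simp [readMap, hy]

theorem HolMapAt.id {x : X} : E.HolMapAt E (fun _ => ContinuousLinearMap.id ℂ F) x := by
  refine (holAt_const (c := ContinuousLinearMap.id ℂ F)).congr_of_eventuallyEq ?_
  filter_upwards [E.eventually_coframe_frame x] with y hy
  ext v
  simp [readMap, hy]

theorem HolMapAt.comp {ψ : X → F' →L[ℂ] F''} {φ : X → F →L[ℂ] F'} {x : X}
    (hψ : E'.HolMapAt E'' ψ x) (hφ : E.HolMapAt E' φ x) :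
    E.HolMapAt E'' (fun y => (ψ y).comp (φ y)) x := by
  refine (ContMDiffAt.clm_comp hψ hφ).congr_of_eventuallyEq ?_
  filter_upwards [E'.eventually_frame_coframe x] with y hy
  ext v
  simp [readMap, hy]

theorem HolMapAt.add {φ ψ : X → F →L[ℂ] F'} {x : X} (hφ : E.HolMapAt E' φ x)
    (hψ : E.HolMapAt E' ψ x) : E.HolMapAt E' (fun y => φ y + ψ y) x := by
  refine (ContMDiffAt.add hφ hψ).congr_of_eventuallyEq (.of_forall fun y => ?_)
  ext v
  simp [readMap]

theorem HolMapAt.sub {φ ψ : X → F →L[ℂ] F'} {x : X} (hφ : E.HolMapAt E' φ x)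
    (hψ : E.HolMapAt E' ψ x) : E.HolMapAt E' (fun y => φ y - ψ y) x := by
  refine (ContMDiffAt.sub hφ hψ).congr_of_eventuallyEq (.of_forall fun y => ?_)
  ext v
  simp [readMap]

theorem HolMapAt.const_smul {φ : X → F →L[ℂ] F'} {x : X} (hφ : E.HolMapAt E' φ x) (c : ℂ) :
    E.HolMapAt E' (fun y => c • φ y) x := by
  refine (ContMDiffAt.smul (holAt_const (c := c)) hφ).congr_of_eventuallyEq
    (.of_forall fun y => ?_)
  ext v
  simp [readMap]

theorem readMap_unreadMap (H : X → F →L[ℂ] F') (x : X) :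
    E.readMap E' (E.unreadMap E' H x) x =ᶠ[𝓝 x] H := by
  filter_upwards [E.eventually_coframe_frame x, E'.eventually_coframe_frame x] with y hy hy'
  ext v
  simp [readMap, unreadMap, hy, hy']

theorem HolMapAt.unreadMap {H : X → F →L[ℂ] F'} {x : X} (hH : HolAt H x) :
    E.HolMapAt E' (E.unreadMap E' H x) x :=
  ContMDiffAt.congr_of_eventuallyEq hH (readMap_unreadMap H x)

/-- Holomorphic bundle maps that agree on a punctured neighbourhood agree at the puncture. -/
theorem HolMapAt.eq_of_eventually_nhdsNE {φ ψ : X → F →L[ℂ] F'} {x : X}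
    (hφ : E.HolMapAt E' φ x) (hψ : E.HolMapAt E' ψ x) (h : ∀ᶠ y in 𝓝[≠] x, φ y = ψ y) :
    φ x = ψ x := by
  rw [← readMap_self (E := E) (E' := E') φ, ← readMap_self (E := E) (E' := E') ψ]
  refine RealCurve.eq_of_eventually_nhdsNE hφ hψ ?_
  filter_upwards [h] with y hy
  simp [readMap, hy]

/-- Gluing: a condition `P` on the values of a bundle map that has local holomorphic solutions, and
at most one solution at each point of some punctured neighbourhood of any point, has a global
holomorphic solution. -/
theorem exists_holMapAt_of_local (E : HolBundle X F) (E' : HolBundle X F')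
    (P : X → (F →L[ℂ] F') → Prop)
    (hloc : ∀ x, ∃ ψ : X → F →L[ℂ] F', E.HolMapAt E' ψ x ∧ ∀ᶠ y in 𝓝 x, P y (ψ y))
    (huniq : ∀ x, ∀ᶠ y in 𝓝[≠] x, ∀ w w', P y w → P y w' → w = w') :
    ∃ ψ : X → F →L[ℂ] F', (∀ x, E.HolMapAt E' ψ x) ∧ ∀ x, P x (ψ x) := by
  choose ψ hψ hP using hloc
  refine ⟨fun x => ψ x x, fun x => (hψ x).congr ?_, fun x => (hP x).self_of_nhds⟩
  filter_upwards [hP x, eventually_nhdsWithin_iff.1 (huniq x)] with y hy hu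
  rcases eq_or_ne y x with rfl | hne
  · rfl
  · exact hu hne _ _ (hP y).self_of_nhds hy

/-! ### Line bundles and scalar maps -/

/-- The transition factor of the line bundle `A` from the distinguished frame around `x` to the
fibre coordinate at `y`. -/
def wt (A : HolLine X) (x y : X) : ℂ := A.frame x y 1

/-- The function `f`, seen as multiplication in fibre coordinates, is a holomorphic map `A → B` of
line bundles near `x`. -/
def HolScAt (A B : HolLine X) (f : X → ℂ) (x : X) : Prop :=
  HolAt (fun y => (B.wt x y)⁻¹ * f y * A.wt x y) x

/-- The order of vanishing at `x` of the map `A → B` of line bundles given by `f`. -/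
def ordSc (A B : HolLine X) (f : X → ℂ) (x : X) : ℕ∞ :=
  ordAt (fun y => (B.wt x y)⁻¹ * f y * A.wt x y) x

variable {A B C C' : HolLine X}

theorem clm_apply_eq (φ : ℂ →L[ℂ] ℂ) (v : ℂ) : φ v = φ 1 * v := by
  have := φ.map_smul v 1
  simpa [mul_comm] using this

theorem clm_apply_eq_smul (φ : ℂ →L[ℂ] F) (v : ℂ) : φ v = v • φ 1 := by
  have := φ.map_smul v 1
  simpa using this

theorem wt_self (A : HolLine X) (x : X) : A.wt x x = 1 := A.frame_self x 1

theorem frame_line (A : HolLine X) (x y : X) (v : ℂ) : A.frame x y v = A.wt x y * v :=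
  clm_apply_eq _ v

theorem eventually_coframe_one (A : HolLine X) (x : X) :
    ∀ᶠ y in 𝓝 x, A.wt x y ≠ 0 ∧ A.coframe x y 1 = (A.wt x y)⁻¹ := by
  filter_upwards [A.eventually_coframe_frame x] with y hy
  have h := hy 1
  rw [frame_line, clm_apply_eq, mul_one] at h
  have h0 : A.wt x y ≠ 0 := fun h' => by simp [h'] at h
  exact ⟨h0, eq_inv_of_mul_eq_one_left h⟩

theorem eventually_wt_ne_zero (A : HolLine X) (x : X) : ∀ᶠ y in 𝓝 x, A.wt x y ≠ 0 :=
  (A.eventually_coframe_one x).mono fun _ h => h.1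

theorem eventually_coframe_line (A : HolLine X) (x : X) :
    ∀ᶠ y in 𝓝 x, ∀ v, A.coframe x y v = (A.wt x y)⁻¹ * v := by
  filter_upwards [A.eventually_coframe_one x] with y hy v
  rw [clm_apply_eq, hy.2]

theorem holMapAt_line_iff {φ : X → ℂ →L[ℂ] ℂ} {x : X} :
    A.HolMapAt B φ x ↔ HolScAt A B (fun y => φ y 1) x := by
  have key : ∀ᶠ y in 𝓝 x, A.readMap B φ x y =
      ((B.wt x y)⁻¹ * φ y 1 * A.wt x y) • ContinuousLinearMap.id ℂ ℂ := by
    filter_upwards [B.eventually_coframe_line x] with y hy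
    ext
    simp only [readMap, ContinuousLinearMap.comp_apply, hy, frame_line, mul_one]
    rw [clm_apply_eq (φ y)]
    simp [mul_assoc]
  constructor
  · intro h
    refine (ContMDiffAt.clm_apply h (contMDiffAt_const (c := (1 : ℂ)))).congr_of_eventuallyEq ?_
    filter_upwards [key] with y hy
    simp [hy]
  · intro h
    exact (ContMDiffAt.smul h
      (holAt_const (c := ContinuousLinearMap.id ℂ ℂ))).congr_of_eventuallyEq key

/-- Multiplication by `f` in fibre coordinates. -/
def sc {Y : Type*} (f : Y → ℂ) (y : Y) : ℂ →L[ℂ] ℂ := f y • ContinuousLinearMap.id ℂ ℂ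

@[simp] theorem sc_apply {Y : Type*} (f : Y → ℂ) (y : Y) (v : ℂ) : sc f y v = f y * v := rfl

theorem holMapAt_sc_iff {f : X → ℂ} {x : X} : A.HolMapAt B (sc f) x ↔ HolScAt A B f x := by
  simp [holMapAt_line_iff]

theorem HolScAt.of_wt {f g : X → ℂ} {x : X} (h : HolScAt A B f x)
    (heq : ∀ᶠ y in 𝓝 x, (C'.wt x y)⁻¹ * g y * C.wt x y = (B.wt x y)⁻¹ * f y * A.wt x y) :
    HolScAt C C' g x :=
  ContMDiffAt.congr_of_eventuallyEq h heq

theorem ordSc_of_wt {f g : X → ℂ} {x : X}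
    (heq : ∀ᶠ y in 𝓝 x, (C'.wt x y)⁻¹ * g y * C.wt x y = (B.wt x y)⁻¹ * f y * A.wt x y) :
    ordSc C C' g x = ordSc A B f x :=
  ordAt_congr heq

theorem HolScAt.congr {f g : X → ℂ} {x : X} (h : HolScAt A B f x)
    (hg : ∀ᶠ y in 𝓝 x, g y = f y) : HolScAt A B g x :=
  h.of_wt (hg.mono fun y hy => by rw [hy])

theorem HolScAt.const {c : ℂ} {x : X} : HolScAt A A (fun _ => c) x := by
  refine (holAt_const (c := c)).congr_of_eventuallyEq ?_
  filter_upwards [A.eventually_wt_ne_zero x] with y hy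
  field_simp

theorem HolScAt.mul {f g : X → ℂ} {x : X} (hf : HolScAt B C f x) (hg : HolScAt A B g x) :
    HolScAt A C (fun y => f y * g y) x := by
  refine (ContMDiffAt.mul hf hg).congr_of_eventuallyEq ?_
  filter_upwards [B.eventually_wt_ne_zero x] with y hy
  simp only [Pi.mul_apply]
  field_simp

theorem ordSc_mul {f g : X → ℂ} {x : X} (hf : HolScAt B C f x) (hg : HolScAt A B g x) :
    ordSc A C (fun y => f y * g y) x = ordSc B C f x + ordSc A B g x := by
  rw [ordSc, ordSc, ordSc, ← ordAt_mul hf hg]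
  refine ordAt_congr ?_
  filter_upwards [B.eventually_wt_ne_zero x] with y hy
  field_simp

theorem HolScAt.add {f g : X → ℂ} {x : X} (hf : HolScAt A B f x) (hg : HolScAt A B g x) :
    HolScAt A B (fun y => f y + g y) x := by
  refine (ContMDiffAt.add hf hg).congr_of_eventuallyEq (.of_forall fun y => ?_)
  simp only [Pi.add_apply]
  ring

theorem HolScAt.inv {f : X → ℂ} {x : X} (hf : HolScAt A B f x) (h0 : f x ≠ 0) :
    HolScAt B A (fun y => (f y)⁻¹) x := by
  refine (ContMDiffAt.inv₀ hf ?_).congr_of_eventuallyEq ?_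
  · simpa [wt_self] using h0
  · refine .of_forall fun y => ?_
    simp only [mul_inv, inv_inv]
    ring

theorem HolScAt.tensor {f g : X → ℂ} {x : X} (hf : HolScAt A B f x) (hg : HolScAt C C' g x) :
    HolScAt (A.tensor C) (B.tensor C') (fun y => f y * g y) x := by
  refine (ContMDiffAt.mul hf hg).congr_of_eventuallyEq (.of_forall fun y => ?_)
  simp only [wt, frame, HolBundle.tensor, Pi.mul_apply, scalar, smul_apply,
    smul_eq_mul, mul_inv]
  ring

theorem HolScAt.ordSc_eq_zero {f : X → ℂ} {x : X} (hf : HolScAt A B f x) :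
    ordSc A B f x = 0 ↔ f x ≠ 0 := by
  rw [ordSc, HolAt.ordAt_eq_zero hf]
  simp [wt_self]

theorem ordSc_eq_top {f : X → ℂ} {x : X} : ordSc A B f x = ⊤ ↔ ∀ᶠ y in 𝓝 x, f y = 0 := by
  rw [ordSc, ordAt_eq_top]
  refine Filter.eventually_congr ?_
  filter_upwards [A.eventually_wt_ne_zero x, B.eventually_wt_ne_zero x] with y hA hB
  simp [hA, hB]

theorem HolScAt.eventually_eq_zero_or_ne_zero {f : X → ℂ} {x : X} (hf : HolScAt A B f x) :
    (∀ᶠ y in 𝓝 x, f y = 0) ∨ ∀ᶠ y in 𝓝[≠] x, f y ≠ 0 := by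
  refine (HolAt.eventually_eq_zero_or_ne_zero hf).imp (fun h => ?_) fun h => ?_
  · filter_upwards [A.eventually_wt_ne_zero x, B.eventually_wt_ne_zero x, h] with y hA hB h
    simpa [hA, hB] using h
  · filter_upwards [h] with y h h'
    exact h (by simp [h'])

theorem HolScAt.eventually_ne_zero {f : X → ℂ} {x : X} (hf : HolScAt A B f x)
    (h : ordSc A B f x ≠ ⊤) : ∀ᶠ y in 𝓝[≠] x, f y ≠ 0 :=
  hf.eventually_eq_zero_or_ne_zero.resolve_left fun h' => h (ordSc_eq_top.2 h')

/-! ### Tensor products, duals and conjugates in frames -/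

theorem wt_tensor (A B : HolLine X) (x y : X) : (A.tensor B).wt x y = A.wt x y * B.wt x y := rfl

theorem wt_trivialLine (x y : X) : (trivialLine X).wt x y = 1 := rfl

theorem eventually_wt_dual (A : HolLine X) (x : X) :
    ∀ᶠ y in 𝓝 x, A.dual.wt x y = (A.wt x y)⁻¹ :=
  (A.eventually_coframe_one x).mono fun _ h => h.2

theorem frame_tensor (A : HolLine X) (E : HolBundle X F) (x y : X) :
    (A.tensor E).frame x y = A.wt x y • E.frame x y := rfl

theorem eventually_coframe_tensor (A : HolLine X) (E : HolBundle X F) (x : X) :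
    ∀ᶠ y in 𝓝 x, (A.tensor E).coframe x y = (A.wt x y)⁻¹ • E.coframe x y :=
  (A.eventually_coframe_one x).mono fun y h => by rw [← h.2]; rfl

theorem HolMapAt.tensor {φ : X → F →L[ℂ] F'} {f : X → ℂ} {x : X} (hf : HolScAt A B f x)
    (hφ : E.HolMapAt E' φ x) :
    (A.tensor E).HolMapAt (B.tensor E') (fun y => f y • φ y) x := by
  refine (ContMDiffAt.smul hf hφ).congr_of_eventuallyEq ?_
  filter_upwards [B.eventually_coframe_tensor E' x] with y hy
  ext v
  simp only [readMap, hy, frame_tensor]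
  simp only [ContinuousLinearMap.comp_apply, smul_apply, map_smul, smul_smul]
  congr 1
  ring

section Conj

variable [IsManifold 𝓘(ℂ) ω X] (τ : RealStructure X)
variable [StarAddMonoid F] [StarModule ℂ F] [ContinuousStar F] [FiniteDimensional ℂ F]
  [StarAddMonoid F'] [StarModule ℂ F'] [ContinuousStar F'] [FiniteDimensional ℂ F']

theorem frame_conjPullback (E : HolBundle X F) (x y : X) (v : F) :
    (E.conjPullback τ).frame x y v = star (E.frame (τ.toFun x) (τ.toFun y) (star v)) := rfl

theorem coframe_conjPullback (E : HolBundle X F) (x y : X) (v : F) :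
    (E.conjPullback τ).coframe x y v = star (E.coframe (τ.toFun x) (τ.toFun y) (star v)) := rfl

theorem wt_conjPullback (A : HolLine X) (x y : X) :
    (A.conjPullback τ).wt x y = conj (A.wt (τ.toFun x) (τ.toFun y)) := by
  rw [wt, frame_conjPullback, star_one]
  rfl

/-- The conjugate of a holomorphic bundle map is a holomorphic map of the conjugate bundles. -/
theorem HolMapAt.conjPullback {φ ψ : X → F →L[ℂ] F'} {x : X}
    (hφ : E.HolMapAt E' φ (τ.toFun x)) (hψ : ∀ y v, ψ y v = star (φ (τ.toFun y) (star v))) :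
    (E.conjPullback τ).HolMapAt (E'.conjPullback τ) ψ x := by
  have : CompleteSpace F' := FiniteDimensional.complete ℂ F'
  refine τ.holAt_conj_clm_comp hφ fun y v => ?_
  simp [readMap, frame_conjPullback, coframe_conjPullback, hψ]

theorem holMapAt_conjPullback_conjPullback {φ : X → F →L[ℂ] F'} {x : X} :
    ((E.conjPullback τ).conjPullback τ).HolMapAt ((E'.conjPullback τ).conjPullback τ) φ x ↔
      E.HolMapAt E' φ x := by
  have : ((E.conjPullback τ).conjPullback τ).readMap ((E'.conjPullback τ).conjPullback τ) φ x =
      E.readMap E' φ x := by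
    funext y
    ext v
    simp [readMap, frame_conjPullback, coframe_conjPullback, τ.apply_apply]
  rw [HolMapAt, this, HolMapAt]

theorem HolScAt.conjPullback {f : X → ℂ} {x : X} (hf : HolScAt A B f (τ.toFun x)) :
    HolScAt (A.conjPullback τ) (B.conjPullback τ) (fun y => conj (f (τ.toFun y))) x := by
  refine ContMDiffAt.congr_of_eventuallyEq (τ.holAt_star_comp hf) (.of_forall fun y => ?_)
  simp [wt_conjPullback]

theorem ordSc_conjPullback {f : X → ℂ} {x : X} (hf : HolScAt A B f (τ.toFun x)) :
    ordSc (A.conjPullback τ) (B.conjPullback τ) (fun y => conj (f (τ.toFun y))) x =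
      ordSc A B f (τ.toFun x) := by
  rw [ordSc, ordSc, ← τ.ordAt_conj_comp hf]
  refine ordAt_congr (.of_forall fun y => ?_)
  simp [wt_conjPullback]

end Conj

/-! ### Sections of line bundles -/

theorem isHolSectionOn_iff {V : Set X} (hV : IsOpen V) {s : X → ℂ} :
    A.IsHolSectionOn V s ↔ ∀ x ∈ V, HolScAt (trivialLine X) A s x := by
  have key : ∀ x, A.localRep s (A.core.indexAt x) =ᶠ[𝓝 x]
      fun y => (A.wt x y)⁻¹ * s y * (trivialLine X).wt x y := by
    intro x
    filter_upwards [A.eventually_coframe_line x] with y hy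
    rw [wt_trivialLine, mul_one, ← hy]
    rfl
  constructor
  · intro h x hx
    refine ((h (A.core.indexAt x)).contMDiffAt ((hV.inter (A.core.isOpen_baseSet _)).mem_nhds
      ⟨hx, A.core.mem_baseSet_at x⟩)).congr_of_eventuallyEq (key x).symm
  · intro h i x hx
    have h1 : HolAt (A.core.coordChange (A.core.indexAt x) i) x :=
      (A.contMDiffOn_coordChange _ i).contMDiffAt
        (((A.core.isOpen_baseSet _).inter (A.core.isOpen_baseSet _)).mem_nhds
          ⟨A.core.mem_baseSet_at x, hx.2⟩)
    refine ((ContMDiffAt.clm_apply h1 (h x hx.1)).congr_of_eventuallyEq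
      ?_).contMDiffWithinAt
    filter_upwards [key x, A.eventually_mem_baseSet x, (A.core.isOpen_baseSet i).mem_nhds hx.2]
      with y hy hy' hi
    rw [← hy, localRep, localRep, A.coordChange_coordChange (A.core.mem_baseSet_at y) hy' hi]

theorem mem_H0_iff {s : X → ℂ} : s ∈ A.H0 ↔ ∀ x, HolScAt (trivialLine X) A s x := by
  refine (isHolSectionOn_iff isOpen_univ).trans ?_
  simp

theorem germ_eventuallyEq (A : HolLine X) (s : X → ℂ) (x : X) :
    A.germ s x =ᶠ[𝓝 (chartAt ℂ x x)]
      (fun y => (A.wt x y)⁻¹ * s y) ∘ (chartAt ℂ x).symm := by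
  filter_upwards [eventually_chart.2 (A.eventually_coframe_line x)] with z hz
  simp only [Function.comp_apply]
  rw [← hz]
  rfl

theorem vanishingOrder_eq (A : HolLine X) (s : X → ℂ) (x : X) :
    A.vanishingOrder s x = ordSc (trivialLine X) A s x := by
  refine analyticOrderAt_congr ((A.germ_eventuallyEq s x).trans (.of_forall fun z => ?_))
  simp [wt_trivialLine]

end HolBundle

end RealCurve

namespace RealCurve

variable {X : Type u} [TopologicalSpace X] [ChartedSpace ℂ X]

namespace HolBundle

variable {A B : HolLine X}

/-! ### Degrees of line bundles -/

theorem isMeromorphicWithDivisor_iff {s : X → ℂ} {D : X →₀ ℤ} :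
    A.IsMeromorphicWithDivisor s D ↔ ∀ x,
      MeromorphicAt ((fun y => (A.wt x y)⁻¹ * s y) ∘ (chartAt ℂ x).symm) (chartAt ℂ x x) ∧
      meromorphicOrderAt ((fun y => (A.wt x y)⁻¹ * s y) ∘ (chartAt ℂ x).symm) (chartAt ℂ x x) =
        ((D x : ℤ) : WithTop ℤ) := by
  refine forall_congr' fun x => ?_
  have h := (A.germ_eventuallyEq s x).filter_mono (nhdsWithin_le_nhds (s := {chartAt ℂ x x}ᶜ))
  rw [meromorphicOrderAt_congr h, MeromorphicAt.meromorphicAt_congr h]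

theorem IsMeromorphicWithDivisor.map {s f : X → ℂ} {D : X →₀ ℤ} {N : X →₀ ℕ}
    (hs : A.IsMeromorphicWithDivisor s D) (hf : ∀ x, HolScAt A B f x)
    (hN : ∀ x, ordSc A B f x = N x) :
    B.IsMeromorphicWithDivisor (fun x => f x * s x)
      (D + N.mapRange (fun n : ℕ => (n : ℤ)) rfl) := by
  rw [isMeromorphicWithDivisor_iff] at hs ⊢
  intro x
  obtain ⟨h1, h2⟩ := hs x
  have h3 := holAt_iff_analyticAt.1 (hf x)
  have h4 : (fun y => (B.wt x y)⁻¹ * (f y * s y)) ∘ (chartAt ℂ x).symm =ᶠ[𝓝[≠] (chartAt ℂ x x)]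
      ((fun y => (B.wt x y)⁻¹ * f y * A.wt x y) ∘ (chartAt ℂ x).symm) *
        ((fun y => (A.wt x y)⁻¹ * s y) ∘ (chartAt ℂ x).symm) := by
    refine Filter.EventuallyEq.filter_mono ?_ nhdsWithin_le_nhds
    filter_upwards [eventually_chart.2 (A.eventually_wt_ne_zero x)] with z hz
    simp only [Function.comp_apply, Pi.mul_apply]
    field_simp
  rw [MeromorphicAt.meromorphicAt_congr h4, meromorphicOrderAt_congr h4,
    meromorphicOrderAt_mul h3.meromorphicAt h1, h3.meromorphicOrderAt_eq, h2]
  refine ⟨h3.meromorphicAt.mul h1, ?_⟩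
  have h5 := hN x
  rw [ordSc, ordAt] at h5
  rw [h5]
  simp [add_comm]

theorem IsMeromorphicWithDivisor.tensor {s t : X → ℂ} {D D' : X →₀ ℤ}
    (hs : A.IsMeromorphicWithDivisor s D) (ht : B.IsMeromorphicWithDivisor t D') :
    (HolBundle.tensor A B).IsMeromorphicWithDivisor (fun x => s x * t x) (D + D') := by
  rw [isMeromorphicWithDivisor_iff] at hs ht ⊢
  intro x
  obtain ⟨h1, h2⟩ := hs x
  obtain ⟨h3, h4⟩ := ht x
  have h5 : (fun y => ((HolBundle.tensor A B).wt x y)⁻¹ * (s y * t y)) ∘ (chartAt ℂ x).symm =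
      ((fun y => (A.wt x y)⁻¹ * s y) ∘ (chartAt ℂ x).symm) *
        ((fun y => (B.wt x y)⁻¹ * t y) ∘ (chartAt ℂ x).symm) := by
    funext z
    simp only [Function.comp_apply, Pi.mul_apply, wt_tensor, mul_inv]
    ring
  rw [h5, meromorphicOrderAt_mul h1 h3, h2, h4]
  exact ⟨h1.mul h3, by simp⟩

theorem IsMeromorphicWithDivisor.dual {s : X → ℂ} {D : X →₀ ℤ}
    (hs : A.IsMeromorphicWithDivisor s D) :
    A.dual.IsMeromorphicWithDivisor (fun x => (s x)⁻¹) (-D) := by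
  rw [isMeromorphicWithDivisor_iff] at hs ⊢
  intro x
  obtain ⟨h1, h2⟩ := hs x
  have h4 : (fun y => (A.dual.wt x y)⁻¹ * (s y)⁻¹) ∘ (chartAt ℂ x).symm =ᶠ[𝓝[≠] (chartAt ℂ x x)]
      ((fun y => (A.wt x y)⁻¹ * s y) ∘ (chartAt ℂ x).symm)⁻¹ := by
    refine Filter.EventuallyEq.filter_mono ?_ nhdsWithin_le_nhds
    filter_upwards [eventually_chart.2 (A.eventually_wt_dual x)] with z hz
    simp only [Function.comp_apply, Pi.inv_apply, hz, mul_inv]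
  rw [MeromorphicAt.meromorphicAt_congr h4, meromorphicOrderAt_congr h4, meromorphicOrderAt_inv, h2]
  exact ⟨h1.inv, rfl⟩

theorem sum_add_divisor {Y : Type*} (D D' : Y →₀ ℤ) :
    ((D + D').sum fun _ n => n) = (D.sum fun _ n => n) + D'.sum fun _ n => n :=
  Finsupp.sum_add_index' (fun _ => rfl) fun _ _ _ => rfl

theorem sum_neg_divisor {Y : Type*} (D : Y →₀ ℤ) :
    ((-D).sum fun _ n => n) = -(D.sum fun _ n => n) := by
  rw [Finsupp.sum_neg_index fun _ => rfl]
  simp [Finsupp.sum]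

theorem sum_natCast_divisor {Y : Type*} (N : Y →₀ ℕ) :
    ((N.mapRange (fun n : ℕ => (n : ℤ)) rfl).sum fun _ n => n) =
      ((N.sum fun _ n => n : ℕ) : ℤ) := by
  rw [Finsupp.sum_mapRange_index fun _ => rfl]
  simp [Finsupp.sum]

/-- The degree of a line bundle is additive along a nonzero holomorphic map: its divisor of zeros
makes up the difference. -/
theorem sum_ordSc {f : X → ℂ} {a b : ℤ} {N : X →₀ ℕ} (hA : A.HasDegree a) (hB : B.HasDegree b)
    (hf : ∀ x, HolScAt A B f x) (hN : ∀ x, ordSc A B f x = N x) :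
    ((N.sum fun _ n => n : ℕ) : ℤ) = b - a := by
  obtain ⟨s, D, hs⟩ := hA.1
  have h1 := hA.2 s D hs
  have h2 := hB.2 _ _ (hs.map hf hN)
  rw [sum_add_divisor, sum_natCast_divisor] at h2
  linarith

/-- In fibre coordinates, an isomorphism of line bundles is a nowhere vanishing scalar function. -/
theorem isom_iff_exists_scalar :
    A.Isom B ↔ ∃ f : X → ℂ, (∀ x, HolScAt A B f x) ∧ ∀ x, f x ≠ 0 := by
  constructor
  · rintro ⟨f, g, h⟩
    refine ⟨fun x => f.fib x 1, fun x => holMapAt_line_iff.1 (f.holMapAt x), fun x hx => ?_⟩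
    have := (h x).1 1
    simp [hx] at this
  · rintro ⟨f, hf, h0⟩
    refine ⟨Map.ofHolMapAt (sc f) fun x => holMapAt_sc_iff.2 (hf x),
      Map.ofHolMapAt (sc fun y => (f y)⁻¹) fun x => holMapAt_sc_iff.2 ((hf x).inv (h0 x)),
      fun x => ⟨fun v => ?_, fun v => ?_⟩⟩ <;>
    simp [Map.ofHolMapAt, h0 x]

theorem HasDegree.of_scalar {f : X → ℂ} {d : ℤ} (hB : B.HasDegree d)
    (hf : ∀ x, HolScAt A B f x) (h0 : ∀ x, f x ≠ 0) : A.HasDegree d := by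
  have hN : ∀ x, ordSc A B f x = (0 : X →₀ ℕ) x := fun x => by
    simpa using (hf x).ordSc_eq_zero.2 (h0 x)
  have hf' : ∀ x, HolScAt B A (fun y => (f y)⁻¹) x := fun x => (hf x).inv (h0 x)
  have hN' : ∀ x, ordSc B A (fun y => (f y)⁻¹) x = (0 : X →₀ ℕ) x := fun x => by
    simpa using (hf' x).ordSc_eq_zero.2 (inv_ne_zero (h0 x))
  refine ⟨?_, fun s D hs => ?_⟩
  · obtain ⟨s, D, hs⟩ := hB.1
    exact ⟨_, _, hs.map hf' hN'⟩
  · simpa using hB.2 _ _ (hs.map hf hN)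

theorem HasDegree.of_isom {d : ℤ} (hB : B.HasDegree d) (h : A.Isom B) : A.HasDegree d := by
  obtain ⟨f, hf, h0⟩ := isom_iff_exists_scalar.1 h
  exact hB.of_scalar hf h0

theorem HasDegree.dual {d : ℤ} (hA : A.HasDegree d) : A.dual.HasDegree (-d) := by
  refine ⟨?_, fun s D hs => ?_⟩
  · obtain ⟨s, D, hs⟩ := hA.1
    exact ⟨_, _, hs.dual⟩
  · have h1 := hA.2 _ _ (hs.dual : A.IsMeromorphicWithDivisor _ _)
    rw [sum_neg_divisor] at h1
    linarith

theorem HasDegree.tensor {a b : ℤ} (hA : A.HasDegree a) (hB : B.HasDegree b) :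
    (HolBundle.tensor A B).HasDegree (a + b) := by
  obtain ⟨s, D, hs⟩ := hA.1
  refine ⟨?_, fun r N hr => ?_⟩
  · obtain ⟨t, D', ht⟩ := hB.1
    exact ⟨_, _, hs.tensor ht⟩
  · have h1 : ∀ x, HolScAt (A.dual.tensor (HolBundle.tensor A B)) B (fun _ => 1) x := fun x => by
      refine (HolScAt.const (A := B) (c := 1)).of_wt ?_
      filter_upwards [A.eventually_wt_ne_zero x, A.eventually_wt_dual x] with y h0 hd
      rw [wt_tensor, wt_tensor, hd]
      field_simp
    have h2 : (A.dual.tensor (HolBundle.tensor A B)).HasDegree b :=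
      hB.of_scalar h1 fun _ => one_ne_zero
    have h3 := h2.2 _ _ (hs.dual.tensor hr)
    rw [sum_add_divisor, sum_neg_divisor, hA.2 s D hs] at h3
    linarith

/-! ### Zeros of holomorphic maps between line bundles -/

/-- The identity theorem: a holomorphic map that does not vanish identically near some point does
not vanish identically near any point. -/
theorem ordSc_ne_top [PreconnectedSpace X] {f : X → ℂ} (hf : ∀ x, HolScAt A B f x) {x₀ : X}
    (h0 : ordSc A B f x₀ ≠ ⊤) (x : X) : ordSc A B f x ≠ ⊤ := by
  have hopen : IsOpen {x | ∀ᶠ y in 𝓝 x, f y = 0} := isOpen_setOfPred_eventually_nhds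
  have hclosed : IsClosed {x | ∀ᶠ y in 𝓝 x, f y = 0} := by
    refine ⟨isOpen_iff_mem_nhds.2 fun x hx => ?_⟩
    have h1 := (hf x).eventually_eq_zero_or_ne_zero.resolve_left hx
    filter_upwards [eventually_nhdsWithin_iff.1 h1] with y hy hy'
    rcases eq_or_ne y x with rfl | hne
    · exact hx hy'
    · exact hy hne hy'.self_of_nhds
  rcases isClopen_iff.1 ⟨hclosed, hopen⟩ with h | h
  · intro hx
    have : x ∈ {x | ∀ᶠ y in 𝓝 x, f y = 0} := ordSc_eq_top.1 hx
    rw [h] at this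
    exact this
  · have : x₀ ∈ {x | ∀ᶠ y in 𝓝 x, f y = 0} := by rw [h]; trivial
    exact absurd (ordSc_eq_top.2 this) h0

theorem exists_divisor [CompactSpace X] {f : X → ℂ} (hf : ∀ x, HolScAt A B f x)
    (h : ∀ x, ordSc A B f x ≠ ⊤) : ∃ N : X →₀ ℕ, ∀ x, ordSc A B f x = N x := by
  have hfin : {x | f x = 0}.Finite := by
    obtain ⟨t, ht⟩ := CompactSpace.elim_nhds_subcover (fun x => {y | y ≠ x → f y ≠ 0})
      fun x => eventually_nhdsWithin_iff.1 ((hf x).eventually_ne_zero (h x))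
    refine t.finite_toSet.subset fun y hy => ?_
    have h1 : y ∈ (⊤ : Set X) := trivial
    rw [← ht] at h1
    simp only [Set.mem_iUnion] at h1
    obtain ⟨x, hx, hxy⟩ := h1
    by_cases hne : y = x
    · rw [hne]; exact hx
    · exact absurd hy (hxy hne)
  refine ⟨Finsupp.ofSupportFinite (fun x => (ordSc A B f x).toNat) (hfin.subset fun x hx => ?_),
    fun x => ?_⟩
  · by_contra h0
    rw [Function.mem_support, (hf x).ordSc_eq_zero.2 h0] at hx
    exact hx rfl
  · exact (ENat.natCast_toNat (h x)).symm

section Degree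

variable [CompactSpace X] [PreconnectedSpace X] {f : X → ℂ} {a b : ℤ}

/-- A holomorphic map between line bundles is zero, or its zeros form a divisor of degree
`deg B - deg A`. -/
theorem eq_zero_or_exists_divisor (hA : A.HasDegree a) (hB : B.HasDegree b)
    (hf : ∀ x, HolScAt A B f x) :
    (∀ x, f x = 0) ∨ ∃ N : X →₀ ℕ, (∀ x, ordSc A B f x = N x) ∧
      ((N.sum fun _ n => n : ℕ) : ℤ) = b - a := by
  by_cases h : ∃ x₀, ordSc A B f x₀ ≠ ⊤
  · obtain ⟨x₀, h0⟩ := h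
    obtain ⟨N, hN⟩ := exists_divisor hf (ordSc_ne_top hf h0)
    exact Or.inr ⟨N, hN, sum_ordSc hA hB hf hN⟩
  · push Not at h
    exact Or.inl fun x => (ordSc_eq_top.1 (h x)).self_of_nhds

theorem eq_zero_of_degree_lt (hA : A.HasDegree a) (hB : B.HasDegree b)
    (hf : ∀ x, HolScAt A B f x) (hab : b < a) (x : X) : f x = 0 := by
  rcases eq_zero_or_exists_divisor hA hB hf with h | ⟨N, -, h⟩
  · exact h x
  · omega

theorem eq_zero_of_degree_eq (hA : A.HasDegree a) (hB : B.HasDegree a)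
    (hf : ∀ x, HolScAt A B f x) {p : X} (hp : f p = 0) (x : X) : f x = 0 := by
  rcases eq_zero_or_exists_divisor hA hB hf with h | ⟨N, hN, h⟩
  · exact h x
  · have h1 : (N.sum fun _ n => n) = 0 := by omega
    have h2 : N p = 0 := by
      by_contra h3
      exact h3 ((Finset.sum_eq_zero_iff.1 h1) p (Finsupp.mem_support_iff.2 h3))
    have h3 := (hf p).ordSc_eq_zero.1 (by rw [hN, h2]; rfl)
    exact absurd hp h3

/-- A nonzero map between line bundles whose degrees differ by one has exactly one zero, which is
simple. -/
theorem eq_zero_or_exists_simple_zero (hA : A.HasDegree a) (hB : B.HasDegree (a + 1))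
    (hf : ∀ x, HolScAt A B f x) :
    (∀ x, f x = 0) ∨ ∃ p, ordSc A B f p = 1 ∧ ∀ x, x ≠ p → f x ≠ 0 := by
  rcases eq_zero_or_exists_divisor hA hB hf with h | ⟨N, hN, h⟩
  · exact Or.inl h
  · have h1 : (N.sum fun _ n => n) = 1 := by omega
    obtain ⟨p, hp⟩ := (Finsupp.sum_eq_one_iff N).1 h1
    refine Or.inr ⟨p, by rw [hN, hp]; simp, fun x hx => ?_⟩
    rw [← (hf x).ordSc_eq_zero, hN, hp, Finsupp.single_eq_of_ne hx]
    rfl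

end Degree

end HolBundle

end RealCurve

namespace RealCurve

variable {X : Type u} [TopologicalSpace X] [ChartedSpace ℂ X]
  {F : Type} [NormedAddCommGroup F] [NormedSpace ℂ F]

open HolBundle

namespace HolBundle

variable {L Q : HolLine X} {E : HolBundle X F}

/-! ### Local splittings and retractions -/

theorem exists_local_splitting {p : X → F →L[ℂ] ℂ} {x : X} (hp : E.HolMapAt Q p x)
    (hsurj : Function.Surjective (p x)) :
    ∃ σ : X → ℂ →L[ℂ] F, Q.HolMapAt E σ x ∧ ∀ᶠ y in 𝓝 x, ∀ q, p y (σ y q) = q := by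
  obtain ⟨v, hv⟩ := hsurj 1
  have hg : HolAt (fun y => E.readMap Q p x y v) x :=
    ContMDiffAt.clm_apply hp (contMDiffAt_const (c := v))
  have hg1 : E.readMap Q p x x v = 1 := by rw [readMap_self, hv]
  have hg0 : E.readMap Q p x x v ≠ 0 := by rw [hg1]; exact one_ne_zero
  have hH : HolAt (fun y => (E.readMap Q p x y v)⁻¹ • ContinuousLinearMap.toSpanSingleton ℂ v) x :=
    ContMDiffAt.smul (hg.inv₀ hg0) contMDiffAt_const
  refine ⟨_, HolMapAt.unreadMap (E := Q) (E' := E) hH, ?_⟩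
  filter_upwards [Q.eventually_frame_coframe x, hg.continuousAt.eventually_ne hg0] with y hy h0 q
  rw [← hy (p y _)]
  conv_rhs => rw [← hy q]
  congr 1
  change E.readMap Q p x y ((E.readMap Q p x y v)⁻¹ • (Q.coframe x y q • v)) = _
  rw [map_smul, map_smul, inv_smul_eq_iff₀ h0, smul_eq_mul, smul_eq_mul, mul_comm]

theorem exists_local_retraction {i : X → ℂ →L[ℂ] F} {x : X} (hi : L.HolMapAt E i x)
    (hinj : Function.Injective (i x)) :
    ∃ ρ : X → F →L[ℂ] ℂ, E.HolMapAt L ρ x ∧ ∀ᶠ y in 𝓝 x, ∀ l, ρ y (i y l) = l := by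
  have hi0 : i x 1 ≠ 0 := fun h => one_ne_zero (hinj (h.trans (map_zero (i x)).symm))
  obtain ⟨f, hf⟩ := SeparatingDual.exists_eq_one (R := ℂ) hi0
  have hg : HolAt (fun y => f (L.readMap E i x y 1)) x :=
    (ContinuousLinearMap.contMDiff f).contMDiffAt.comp x
      (ContMDiffAt.clm_apply hi (contMDiffAt_const (c := (1 : ℂ))))
  have hg0 : f (L.readMap E i x x 1) ≠ 0 := by rw [readMap_self, hf]; exact one_ne_zero
  have hH : HolAt (fun y => (f (L.readMap E i x y 1))⁻¹ • f) x :=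
    ContMDiffAt.smul (hg.inv₀ hg0) contMDiffAt_const
  refine ⟨_, HolMapAt.unreadMap (E := E) (E' := L) hH, ?_⟩
  filter_upwards [L.eventually_frame_coframe x, hg.continuousAt.eventually_ne hg0] with y hy h0 l
  conv_rhs => rw [← hy l]
  change L.frame x y _ = _
  congr 1
  have h1 : E.coframe x y (i y l) = L.coframe x y l • L.readMap E i x y 1 := by
    rw [← clm_apply_eq_smul]
    simp [readMap, hy]
  change (f (L.readMap E i x y 1))⁻¹ • f (E.coframe x y (i y l)) = _
  rw [h1, map_smul, smul_eq_mul, smul_eq_mul]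
  field_simp

/-! ### Twisting scalar maps -/

theorem HolScAt.tensor_left {B : HolLine X} {t : X → ℂ} {x : X}
    (h : HolScAt (trivialLine X) B t x) : HolScAt Q (Q.tensor B) t x := by
  refine h.of_wt ?_
  filter_upwards [Q.eventually_wt_ne_zero x] with y h1
  rw [wt_tensor, wt_trivialLine]
  field_simp

theorem HolScAt.of_tensor_left {B : HolLine X} {t : X → ℂ} {x : X}
    (h : HolScAt Q (Q.tensor B) t x) : HolScAt (trivialLine X) B t x := by
  refine h.of_wt ?_
  filter_upwards [Q.eventually_wt_ne_zero x] with y h1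
  rw [wt_tensor, wt_trivialLine]
  field_simp

theorem holScAt_serreDualLine_iff [IsManifold 𝓘(ℂ) ω X] {t : X → ℂ} {x : X} :
    HolScAt (trivialLine X) (Extension.serreDualLine L Q) t x ↔
      HolScAt L (Q.tensor (canonical X)) t x := by
  have key : ∀ᶠ y in 𝓝 x, ((Q.tensor (canonical X)).wt x y)⁻¹ * t y * L.wt x y =
      ((Extension.serreDualLine L Q).wt x y)⁻¹ * t y * (trivialLine X).wt x y := by
    filter_upwards [L.eventually_wt_ne_zero x, L.eventually_wt_dual x] with y h1 h2
    rw [Extension.serreDualLine, wt_tensor, wt_tensor, wt_tensor, wt_trivialLine, h2]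
    field_simp
  exact ⟨fun h => h.of_wt key, fun h => h.of_wt (key.mono fun _ h => h.symm)⟩

theorem ordSc_serreDualLine [IsManifold 𝓘(ℂ) ω X] {t : X → ℂ} {x : X} :
    ordSc (trivialLine X) (Extension.serreDualLine L Q) t x =
      ordSc L (Q.tensor (canonical X)) t x := by
  refine ordSc_of_wt ?_
  filter_upwards [L.eventually_wt_ne_zero x, L.eventually_wt_dual x] with y h1 h2
  rw [Extension.serreDualLine, wt_tensor, wt_tensor, wt_tensor, wt_trivialLine, h2]
  field_simp

end HolBundle

namespace Extension

variable {L Q : HolLine X} {E E₁ E₂ : HolVec X 2}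

/-! ### Split extensions and uniqueness of the subbundle inclusion -/

/-- The extension is split by a global holomorphic map. -/
def Splits (S : Extension L E Q) : Prop :=
  ∃ σ : X → ℂ →L[ℂ] (Fin 2 → ℂ), (∀ x, Q.HolMapAt E σ x) ∧ ∀ x q, S.proj.fib x (σ x q) = q

theorem proj_inc (S : Extension L E Q) (x : X) (l : ℂ) : S.proj.fib x (S.inc.fib x l) = 0 :=
  (S.exact x _).2 ⟨l, rfl⟩

theorem exists_inc_eq (S : Extension L E Q) {x : X} {v : Fin 2 → ℂ} (h : S.proj.fib x v = 0) :
    ∃ l, S.inc.fib x l = v :=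
  (S.exact x v).1 h

/-- A splitting would embed the quotient, of degree one, in a semistable bundle of degree one. -/
theorem not_splits (S : Extension L E Q) (hE : E.IsSemistable) (hQ : Q.HasDegree 1)
    (hdet : E.det.HasDegree 1) : ¬ S.Splits := by
  rintro ⟨σ, hσ, hp⟩
  have := hE Q (Map.ofHolMapAt σ hσ)
    (fun x => Function.LeftInverse.injective (g := S.proj.fib x) (hp x)) 1 1 hQ hdet
  norm_num at this

/-- If the extension does not split, every map `L → E` is a multiple of the inclusion. Otherwise
the composite `L → E → Q` vanishes at one point only, to first order. Subtracting a multiple of the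
inclusion, the map itself vanishes there, and dividing it by the composite splits `Q`. -/
theorem exists_eq_smul_inc [CompactSpace X] [ConnectedSpace X] (S : Extension L E Q) {a : ℤ}
    (hL : L.HasDegree a) (hQ : Q.HasDegree (a + 1)) (hS : ¬ S.Splits) {g : X → ℂ →L[ℂ] (Fin 2 → ℂ)}
    (hg : ∀ x, L.HolMapAt E g x) : ∃ c : ℂ, ∀ x, g x = c • S.inc.fib x := by
  have hr : ∀ x, HolScAt L Q (fun y => S.proj.fib y (g y 1)) x := fun x =>
    holMapAt_line_iff.1 ((S.proj.holMapAt x).comp (hg x))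
  -- at a point where the composite vanishes, subtract the value of `g`
  have sub : ∀ p, S.proj.fib p (g p 1) = 0 → ∃ c : ℂ, (g p - c • S.inc.fib p) 1 = 0 := by
    intro p hp
    obtain ⟨c, hc⟩ := S.exists_inc_eq hp
    refine ⟨c, ?_⟩
    rw [sub_apply, smul_apply, ← hc, clm_apply_eq_smul (S.inc.fib p) c, sub_self]
  have hproj : ∀ (c : ℂ) (y : X), S.proj.fib y ((g y - c • S.inc.fib y) 1) =
      S.proj.fib y (g y 1) := fun c y => by
    rw [sub_apply, smul_apply, map_sub, map_smul, S.proj_inc, smul_zero, sub_zero]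
  rcases eq_zero_or_exists_simple_zero hL hQ hr with h0 | ⟨p, hp, hne⟩
    -- the composite vanishes, so that `g` factors through the inclusion, by a map `L → L`; it is
    -- zero once `g` is corrected so as to vanish at some point
  · obtain ⟨p⟩ := (inferInstance : Nonempty X)
    obtain ⟨c, hc⟩ := sub p (h0 p)
    have hg' : ∀ x, L.HolMapAt E (fun y => g y - c • S.inc.fib y) x := fun x =>
      (hg x).sub ((S.inc.holMapAt x).const_smul c)
    have hf : ∀ x, ∃ l, S.inc.fib x l = (g x - c • S.inc.fib x) 1 := fun x =>
      S.exists_inc_eq ((hproj c x).trans (h0 x))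
    choose f hf using hf
    have hfhol : ∀ x, HolScAt L L f x := by
      intro x
      obtain ⟨ρ, hρ, hρi⟩ := exists_local_retraction (S.inc.holMapAt x) (S.inc_injective x)
      refine (holMapAt_line_iff.1 (hρ.comp (hg' x))).congr ?_
      filter_upwards [hρi] with y hy
      rw [ContinuousLinearMap.comp_apply, ← hf, hy]
    have hfp : f p = 0 := S.inc_injective p (by rw [hf, hc, map_zero])
    refine ⟨c, fun x => ?_⟩
    have h1 := hf x
    rw [eq_zero_of_degree_eq hL hL hfhol hfp x, map_zero] at h1
    ext1
    rw [sub_apply] at h1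
    exact (sub_eq_zero.1 h1.symm)
  · exfalso
    have hp0 : S.proj.fib p (g p 1) = 0 := by
      by_contra h
      rw [(hr p).ordSc_eq_zero.2 h] at hp
      exact zero_ne_one hp
    obtain ⟨c, hc⟩ := sub p hp0
    have hg' : ∀ x, L.HolMapAt E (fun y => g y - c • S.inc.fib y) x := fun x =>
      (hg x).sub ((S.inc.holMapAt x).const_smul c)
    have hord : ∀ x, ordSc L Q (fun y => S.proj.fib y (g y 1)) x ≠ ⊤ ∧
        ordSc L Q (fun y => S.proj.fib y (g y 1)) x ≤
          ordAt (L.readMap E (fun y => g y - c • S.inc.fib y) x) x := by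
      intro x
      rcases eq_or_ne x p with rfl | hx
      · rw [hp, Order.one_le_iff_ne_zero]
        refine ⟨ENat.one_ne_top, fun h => ?_⟩
        rw [HolAt.ordAt_eq_zero (hg' x), readMap_self] at h
        refine h ?_
        ext1
        exact hc
      · rw [(hr x).ordSc_eq_zero.2 (hne x hx)]
        exact ⟨ENat.zero_ne_top, zero_le⟩
    have hrne : ∀ x, ∀ᶠ y in 𝓝[≠] x, S.proj.fib y (g y 1) ≠ 0 := fun x =>
      (hr x).eventually_ne_zero (hord x).1
    obtain ⟨σ, hσ, hσg⟩ := exists_holMapAt_of_local Q E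
      (fun y w => ∀ q, S.proj.fib y (g y 1) • w q = (g y - c • S.inc.fib y) q)
      (fun x => by
        obtain ⟨h, hh, hrh⟩ := exists_local_quotient (hr x) (hg' x) (hord x).1 (hord x).2
        refine ⟨_, HolMapAt.unreadMap (E := Q) (E' := E) hh, ?_⟩
        filter_upwards [hrh, L.eventually_wt_ne_zero x, Q.eventually_coframe_line x,
          Q.eventually_wt_ne_zero x, E.eventually_frame_coframe x] with y h1 h2 h3 h4 h5 q
        have h6 := congrArg (E.frame x y) (congrArg (fun φ : ℂ →L[ℂ] (Fin 2 → ℂ) => φ 1) h1)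
        simp only [smul_apply, map_smul, readMap, ContinuousLinearMap.comp_apply, h5,
          frame_line, mul_one] at h6
        rw [clm_apply_eq_smul (g y - c • S.inc.fib y) (L.wt x y)] at h6
        have h7 : (g y - c • S.inc.fib y) 1 = ((Q.wt x y)⁻¹ * S.proj.fib y (g y 1)) •
            E.frame x y (h y 1) := by
          rw [← smul_right_inj h2, ← h6, smul_smul]
          congr 1
          ring
        rw [clm_apply_eq_smul (g y - c • S.inc.fib y) q, h7]
        simp only [unreadMap, ContinuousLinearMap.comp_apply, h3]
        rw [clm_apply_eq_smul (h y), map_smul, smul_smul, smul_smul]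
        congr 1
        ring)
      (fun x => by
        filter_upwards [hrne x] with y hy w w' hw hw'
        ext1
        have := (hw 1).trans (hw' 1).symm
        exact (smul_right_inj hy).1 this)
    refine hS ⟨σ, hσ, fun x q => ?_⟩
    have h1 := ((S.proj.holMapAt x).comp (hσ x)).eq_of_eventually_nhdsNE HolMapAt.id (by
      filter_upwards [hrne x] with y hy
      ext1
      have h2 := congrArg (S.proj.fib y) (hσg y 1)
      rw [hproj, map_smul, smul_eq_mul] at h2
      simpa [hy] using h2)
    exact congrArg (fun φ : ℂ →L[ℂ] ℂ => φ q) h1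

/-! ### Annihilated sections as extensions of maps -/

/-- A local retraction onto the subbundle, vanishing on a given local splitting. -/
theorem exists_local_retraction_of_splitting (S : Extension L E Q) {x : X}
    {σ : X → ℂ →L[ℂ] (Fin 2 → ℂ)} (hσ : Q.HolMapAt E σ x)
    (hp : ∀ᶠ y in 𝓝 x, ∀ q, S.proj.fib y (σ y q) = q) :
    ∃ ℓ : X → (Fin 2 → ℂ) →L[ℂ] ℂ, E.HolMapAt L ℓ x ∧ ∀ᶠ y in 𝓝 x,
      (∀ l, ℓ y (S.inc.fib y l) = l) ∧ ∀ q, ℓ y (σ y q) = 0 := by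
  obtain ⟨ρ, hρ, hρi⟩ := exists_local_retraction (S.inc.holMapAt x) (S.inc_injective x)
  refine ⟨_, hρ.comp (HolMapAt.id.sub (hσ.comp (S.proj.holMapAt x))), ?_⟩
  filter_upwards [hρi, hp] with y h1 h2
  refine ⟨fun l => ?_, fun q => ?_⟩
  · simp [S.proj_inc, h1]
  · simp [h2]

theorem decomp (S : Extension L E Q) {x : X} {σ : ℂ →L[ℂ] (Fin 2 → ℂ)}
    (hσ : ∀ q, S.proj.fib x (σ q) = q) (v : Fin 2 → ℂ) :
    ∃ l, v = S.inc.fib x l + σ (S.proj.fib x v) := by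
  obtain ⟨l, hl⟩ := S.exists_inc_eq (x := x) (v := v - σ (S.proj.fib x v)) (by simp [hσ])
  exact ⟨l, by rw [hl]; abel⟩

variable [IsManifold 𝓘(ℂ) ω X]

/-- If the cup product of `t : L → Q ⊗ K` with the extension class vanishes, then `t` extends to
`E`: the local extensions given by the splittings are corrected by the cochain bounding the cup
product. -/
theorem Annihilates.exists_map {S : Extension L E Q} {t : X → ℂ}
    (ht : ∀ x, HolScAt L (Q.tensor (canonical X)) t x) (h : S.Annihilates t) :
    ∃ φ : X → (Fin 2 → ℂ) →L[ℂ] ℂ, (∀ x, E.HolMapAt (Q.tensor (canonical X)) φ x) ∧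
      ∀ x l, φ x (S.inc.fib x l) = t x * l := by
  obtain ⟨𝒱, c, ⟨σ, hσ, hpσ, hc⟩, k, hk, hck⟩ := h
  obtain ⟨φ, hφ, hP⟩ := exists_holMapAt_of_local E (Q.tensor (canonical X))
    (fun y w => (∀ l, w (S.inc.fib y l) = t y * l) ∧
      ∀ a, y ∈ 𝒱.V a → ∀ q, w (σ a y q) = k a y * q)
    (fun x => by
      obtain ⟨a, ha⟩ := 𝒱.covers x
      have hV : ∀ᶠ y in 𝓝 x, y ∈ 𝒱.V a := (𝒱.isOpen a).mem_nhds ha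
      have hσx := (isHolMapOn_iff (𝒱.isOpen a)).1 (hσ a) x ha
      obtain ⟨ℓ, hℓ, hℓ'⟩ := S.exists_local_retraction_of_splitting hσx (hV.mono (hpσ a))
      have hkx : HolScAt Q (Q.tensor (canonical X)) (k a) x :=
        ((isHolSectionOn_iff (𝒱.isOpen a)).1 (hk a) x ha).tensor_left
      refine ⟨_, ((holMapAt_sc_iff.2 (ht x)).comp hℓ).add
        ((holMapAt_sc_iff.2 hkx).comp (S.proj.holMapAt x)), ?_⟩
      filter_upwards [hℓ', hV] with y h1 hy
      have h2 : ∀ l, (sc t y ∘L ℓ y + sc (k a) y ∘L S.proj.fib y) (S.inc.fib y l) = t y * l :=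
        fun l => by simp [h1.1, S.proj_inc]
      refine ⟨h2, fun b hb q => ?_⟩
      have h3 : σ b y q = σ a y q + S.inc.fib y (c.c a b y * q) := by
        rw [← hc a b y ⟨hy, hb⟩ q]; abel
      rw [h3, map_add, h2]
      have h4 := hck a b y ⟨hy, hb⟩
      simp only [add_apply, ContinuousLinearMap.comp_apply, sc_apply, h1.2, hpσ a y hy]
      linear_combination q * h4)
    (fun x => .of_forall fun y w w' hw hw' => by
      obtain ⟨a, ha⟩ := 𝒱.covers y
      ext1 v
      obtain ⟨l, hl⟩ := S.decomp (hpσ a y ha) v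
      rw [hl, map_add, map_add, hw.1, hw'.1, hw.2 a ha, hw'.2 a ha])
  exact ⟨φ, hφ, fun x => (hP x).1⟩

/-- If `t : L → Q ⊗ K` extends to `E`, then its cup product with the extension class vanishes. The
annihilated section `s` only serves to provide a cover on which the extension splits. -/
theorem annihilates_of_map {S : Extension L E Q} {s t : X → ℂ} (h : S.Annihilates s)
    {φ : X → (Fin 2 → ℂ) →L[ℂ] ℂ} (hφ : ∀ x, E.HolMapAt (Q.tensor (canonical X)) φ x)
    (hφt : ∀ x l, φ x (S.inc.fib x l) = t x * l) : S.Annihilates t := by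
  obtain ⟨𝒱, c, ⟨σ, hσ, hpσ, hc⟩, -⟩ := h
  refine ⟨𝒱, c, ⟨σ, hσ, hpσ, hc⟩, fun a x => φ x (σ a x 1), fun a => ?_, fun a b x hx => ?_⟩
  · rw [isHolSectionOn_iff (𝒱.isOpen a)]
    intro x hx
    exact (holMapAt_line_iff.1 ((hφ x).comp
      ((isHolMapOn_iff (𝒱.isOpen a)).1 (hσ a) x hx))).of_tensor_left
  · have h1 := congrArg (φ x) (hc a b x hx 1)
    rw [hφt, map_sub, mul_one] at h1
    exact h1.symm

end Extension

end RealCurve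

namespace RealCurve

variable {X : Type u} [TopologicalSpace X] [ChartedSpace ℂ X]

open HolBundle

namespace Extension

variable {L Q K : HolLine X} {E E₁ E₂ : HolVec X 2}

/-! ### Comparison of two extensions with the same annihilated section -/

/-- An extension `φ : E → Q ⊗ K` of `s : L → Q ⊗ K` embeds `E` in `Q ⊕ Q ⊗ K` fibrewise wherever
`s` does not vanish. -/
theorem eq_of_proj_eq_of_map_eq (S : Extension L E Q) {s : X → ℂ}
    {φ : X → (Fin 2 → ℂ) →L[ℂ] ℂ} (hφ : ∀ x l, φ x (S.inc.fib x l) = s x * l) {x : X}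
    (hs : s x ≠ 0) {v w : Fin 2 → ℂ} (h₁ : S.proj.fib x v = S.proj.fib x w)
    (h₂ : φ x v = φ x w) : v = w := by
  obtain ⟨l, hl⟩ := S.exists_inc_eq (x := x) (v := v - w) (by rw [map_sub, h₁, sub_self])
  have h3 := hφ x l
  rw [hl, map_sub, h₂, sub_self, zero_eq_mul] at h3
  rw [h3.resolve_left hs, map_zero] at hl
  exact sub_eq_zero.1 hl.symm

/-- A map `E₁ → E₂` over `Q` with prescribed composite with `φ₂ : E₂ → Q ⊗ K`. It exists as soon as
the local obstruction, the value of the prescribed composite on a local splitting, is divisible by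
`s`. -/
theorem exists_map_of_local (S₁ : Extension L E₁ Q) (S₂ : Extension L E₂ Q) {s : X → ℂ}
    (hs : ∀ x, ∀ᶠ y in 𝓝[≠] x, s y ≠ 0)
    {φ₁ φ₂ : X → (Fin 2 → ℂ) →L[ℂ] ℂ}
    (hφ₁ : ∀ x l, φ₁ x (S₁.inc.fib x l) = s x * l)
    (hφ₂ : ∀ x l, φ₂ x (S₂.inc.fib x l) = s x * l) (c : ℂ) (r : X → ℂ)
    (hloc : ∀ x, ∃ σ₁ σ₂ : X → ℂ →L[ℂ] (Fin 2 → ℂ), ∃ h : X → ℂ,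
      Q.HolMapAt E₁ σ₁ x ∧ Q.HolMapAt E₂ σ₂ x ∧ HolScAt Q L h x ∧ ∀ᶠ y in 𝓝 x,
        (∀ q, S₁.proj.fib y (σ₁ y q) = q) ∧ (∀ q, S₂.proj.fib y (σ₂ y q) = q) ∧
        s y * h y = c * φ₁ y (σ₁ y 1) + r y - φ₂ y (σ₂ y 1)) :
    ∃ ψ : X → (Fin 2 → ℂ) →L[ℂ] (Fin 2 → ℂ), (∀ x, E₁.HolMapAt E₂ ψ x) ∧
      (∀ x v, S₂.proj.fib x (ψ x v) = S₁.proj.fib x v) ∧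
      ∀ x v, φ₂ x (ψ x v) = c * φ₁ x v + r x * S₁.proj.fib x v := by
  obtain ⟨ψ, hψ, hP⟩ := exists_holMapAt_of_local E₁ E₂
    (fun y w => ∀ v, S₂.proj.fib y (w v) = S₁.proj.fib y v ∧
      φ₂ y (w v) = c * φ₁ y v + r y * S₁.proj.fib y v)
    (fun x => by
      obtain ⟨σ₁, σ₂, h, h₁, h₂, hh, hev⟩ := hloc x
      obtain ⟨ℓ, hℓ, hℓ'⟩ := S₁.exists_local_retraction_of_splitting h₁ (hev.mono fun y hy => hy.1)
      refine ⟨_, (h₂.comp (S₁.proj.holMapAt x)).add ((S₂.inc.holMapAt x).comp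
        ((hℓ.const_smul c).add ((holMapAt_sc_iff.2 hh).comp (S₁.proj.holMapAt x)))), ?_⟩
      filter_upwards [hev, hℓ'] with y ⟨e₁, e₂, e₃⟩ ⟨f₁, f₂⟩ v
      refine ⟨by simp [e₂, S₂.proj_inc], ?_⟩
      obtain ⟨l, hl⟩ := S₁.decomp e₁ v
      have hℓv : ℓ y v = l := by rw [hl, map_add, f₁, f₂, add_zero]
      have hφv : φ₁ y v = s y * l + S₁.proj.fib y v * φ₁ y (σ₁ y 1) := by
        conv_lhs => rw [hl]
        rw [map_add, hφ₁, clm_apply_eq_smul (σ₁ y), map_smul, smul_eq_mul]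
      simp only [add_apply, ContinuousLinearMap.comp_apply, smul_apply, sc_apply, map_add, hφ₂,
        hℓv, hφv, smul_eq_mul]
      rw [clm_apply_eq_smul (σ₂ y), map_smul, smul_eq_mul]
      linear_combination S₁.proj.fib y v * e₃)
    (fun x => by
      filter_upwards [hs x] with y hy w w' hw hw'
      ext1 v
      exact S₂.eq_of_proj_eq_of_map_eq hφ₂ hy ((hw v).1.trans (hw' v).1.symm)
        ((hw v).2.trans (hw' v).2.symm))
  exact ⟨ψ, hψ, fun x v => (hP x v).1, fun x v => (hP x v).2⟩

/-- Two extensions of `Q` by `L` are isomorphic bundles as soon as their local obstructions are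
proportional, up to a global section, modulo `s`. -/
theorem isom_of_local (S₁ : Extension L E₁ Q) (S₂ : Extension L E₂ Q) {s : X → ℂ}
    (hs : ∀ x, ∀ᶠ y in 𝓝[≠] x, s y ≠ 0)
    {φ₁ φ₂ : X → (Fin 2 → ℂ) →L[ℂ] ℂ}
    (hφ₁ : ∀ x l, φ₁ x (S₁.inc.fib x l) = s x * l)
    (hφ₂ : ∀ x l, φ₂ x (S₂.inc.fib x l) = s x * l) {c : ℂ} (hc : c ≠ 0) (r : X → ℂ)
    (hloc : ∀ x, ∃ σ₁ σ₂ : X → ℂ →L[ℂ] (Fin 2 → ℂ), ∃ h : X → ℂ,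
      Q.HolMapAt E₁ σ₁ x ∧ Q.HolMapAt E₂ σ₂ x ∧ HolScAt Q L h x ∧ ∀ᶠ y in 𝓝 x,
        (∀ q, S₁.proj.fib y (σ₁ y q) = q) ∧ (∀ q, S₂.proj.fib y (σ₂ y q) = q) ∧
        s y * h y = c * φ₁ y (σ₁ y 1) + r y - φ₂ y (σ₂ y 1)) :
    E₁.Isom E₂ := by
  obtain ⟨ψ, hψ, hψp, hψφ⟩ := exists_map_of_local S₁ S₂ hs hφ₁ hφ₂ c r hloc
  obtain ⟨χ, hχ, hχp, hχφ⟩ := exists_map_of_local S₂ S₁ hs hφ₂ hφ₁ c⁻¹ (fun x => -c⁻¹ * r x)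
    (fun x => by
      obtain ⟨σ₁, σ₂, h, h₁, h₂, hh, hev⟩ := hloc x
      refine ⟨σ₂, σ₁, fun y => h y * -c⁻¹, h₂, h₁, hh.mul HolScAt.const, ?_⟩
      filter_upwards [hev] with y ⟨e₁, e₂, e₃⟩
      refine ⟨e₂, e₁, ?_⟩
      rw [← mul_assoc, e₃]
      field_simp
      ring)
  refine ⟨Map.ofHolMapAt ψ hψ, Map.ofHolMapAt χ hχ, fun x => ⟨fun v => ?_, fun v => ?_⟩⟩
  · have h1 := ((hχ x).comp (hψ x)).eq_of_eventually_nhdsNE HolMapAt.id (by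
      filter_upwards [hs x] with y hy
      ext1 v
      refine S₁.eq_of_proj_eq_of_map_eq hφ₁ hy ?_ ?_
      · simp [hχp, hψp]
      · simp only [ContinuousLinearMap.comp_apply, hχφ, hψφ, hψp, ContinuousLinearMap.id_apply]
        field_simp
        ring)
    exact congrArg (fun φ : (Fin 2 → ℂ) →L[ℂ] (Fin 2 → ℂ) => φ v) h1
  · have h1 := ((hψ x).comp (hχ x)).eq_of_eventually_nhdsNE HolMapAt.id (by
      filter_upwards [hs x] with y hy
      ext1 v
      refine S₂.eq_of_proj_eq_of_map_eq hφ₂ hy ?_ ?_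
      · simp [hχp, hψp]
      · simp only [ContinuousLinearMap.comp_apply, hχφ, hψφ, hχp, ContinuousLinearMap.id_apply]
        field_simp
        ring)
    exact congrArg (fun φ : (Fin 2 → ℂ) →L[ℂ] (Fin 2 → ℂ) => φ v) h1

/-- An extension splits as soon as its local obstructions agree with a global section modulo `s`. -/
theorem splits_of_local (S : Extension L E Q) {s : X → ℂ} (hs : ∀ x, ∀ᶠ y in 𝓝[≠] x, s y ≠ 0)
    {φ : X → (Fin 2 → ℂ) →L[ℂ] ℂ} (hφ : ∀ x l, φ x (S.inc.fib x l) = s x * l) (r : X → ℂ)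
    (hloc : ∀ x, ∃ σ : X → ℂ →L[ℂ] (Fin 2 → ℂ), ∃ h : X → ℂ,
      Q.HolMapAt E σ x ∧ HolScAt Q L h x ∧ ∀ᶠ y in 𝓝 x,
        (∀ q, S.proj.fib y (σ y q) = q) ∧ s y * h y = r y - φ y (σ y 1)) :
    S.Splits := by
  obtain ⟨σ, hσ, hP⟩ := exists_holMapAt_of_local Q E
    (fun y w => ∀ q, S.proj.fib y (w q) = q ∧ φ y (w q) = r y * q)
    (fun x => by
      obtain ⟨σ, h, hσ, hh, hev⟩ := hloc x
      refine ⟨_, hσ.add ((S.inc.holMapAt x).comp (holMapAt_sc_iff.2 hh)), ?_⟩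
      filter_upwards [hev] with y ⟨e₁, e₂⟩ q
      refine ⟨by simp [e₁, S.proj_inc], ?_⟩
      simp only [add_apply, ContinuousLinearMap.comp_apply, sc_apply, map_add, hφ]
      rw [clm_apply_eq_smul (σ y), map_smul, smul_eq_mul]
      linear_combination q * e₂)
    (fun x => by
      filter_upwards [hs x] with y hy w w' hw hw'
      ext1
      exact S.eq_of_proj_eq_of_map_eq hφ hy ((hw 1).1.trans (hw' 1).1.symm)
        ((hw 1).2.trans (hw' 1).2.symm))
  exact ⟨σ, hσ, fun x q => (hP x q).1⟩

end Extension

namespace HolBundle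

variable {A B C L Q K : HolLine X}

theorem ordSc_const_mul {f : X → ℂ} {x : X} (hf : HolScAt A B f x) {c : ℂ} (hc : c ≠ 0) :
    ordSc A B (fun y => c * f y) x = ordSc A B f x := by
  rw [ordSc_mul (HolScAt.const (A := B) (c := c)) hf,
    (HolScAt.const (A := B) (c := c) (x := x)).ordSc_eq_zero.2 hc, zero_add]

/-- A global quotient of scalar maps that are locally divisible. -/
theorem exists_quotient_of_local {s r : X → ℂ} (hs : ∀ x, ∀ᶠ y in 𝓝[≠] x, s y ≠ 0)
    (hloc : ∀ x, ∃ h : X → ℂ, HolScAt A B h x ∧ ∀ᶠ y in 𝓝 x, s y * h y = r y) :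
    ∃ h : X → ℂ, (∀ x, HolScAt A B h x) ∧ ∀ x, s x * h x = r x := by
  obtain ⟨h, hh, hP⟩ := exists_holMapAt_of_local A B (fun y w => s y * w 1 = r y)
    (fun x => by
      obtain ⟨h, hh, hev⟩ := hloc x
      exact ⟨sc h, holMapAt_sc_iff.2 hh, hev.mono fun y hy => by simpa using hy⟩)
    (fun x => by
      filter_upwards [hs x] with y hy w w' hw hw'
      ext1
      exact mul_left_cancel₀ hy (hw.trans hw'.symm))
  exact ⟨_, fun x => holMapAt_line_iff.1 (hh x), hP⟩

/-- Local division of scalar maps `s : A → C` and `r : B → C`. -/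
theorem exists_local_quotient_of_ordSc_le {s r : X → ℂ} {x : X} (hs : HolScAt A C s x)
    (hr : HolScAt B C r x) (htop : ordSc A C s x ≠ ⊤) (hle : ordSc A C s x ≤ ordSc B C r x) :
    ∃ h : X → ℂ, HolScAt B A h x ∧ ∀ᶠ y in 𝓝 x, s y * h y = r y := by
  obtain ⟨h, hh, hev⟩ := exists_local_quotient hs hr htop hle
  refine ⟨fun y => A.wt x y * h y * (B.wt x y)⁻¹, ContMDiffAt.congr_of_eventuallyEq hh ?_, ?_⟩
  · filter_upwards [A.eventually_wt_ne_zero x, B.eventually_wt_ne_zero x] with y hA hB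
    field_simp
  · filter_upwards [A.eventually_wt_ne_zero x, B.eventually_wt_ne_zero x,
      C.eventually_wt_ne_zero x, hev] with y hA hB hC h1
    rw [smul_eq_mul] at h1
    field_simp at h1 ⊢
    linear_combination h1

/-- The `j`-th derivative at `x`, in the distinguished frames and chart, of the map `A → B` given
by `f`. -/
def jetSc (A B : HolLine X) (j : ℕ) (f : X → ℂ) (x : X) : ℂ :=
  jet j (fun y => (B.wt x y)⁻¹ * f y * A.wt x y) x

theorem jetSc_add {f g : X → ℂ} {x : X} (hf : HolScAt A B f x) (hg : HolScAt A B g x) (j : ℕ) :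
    jetSc A B j (fun y => f y + g y) x = jetSc A B j f x + jetSc A B j g x := by
  rw [jetSc, jetSc, jetSc, ← jet_add hf hg]
  congr 1
  funext y
  ring

theorem jetSc_const_mul {f : X → ℂ} {x : X} (hf : HolScAt A B f x) (c : ℂ) (j : ℕ) :
    jetSc A B j (fun y => c * f y) x = c * jetSc A B j f x := by
  rw [jetSc, jetSc, ← jet_const_mul hf]
  congr 1
  funext y
  ring

theorem HolScAt.const_mul {f : X → ℂ} {x : X} (hf : HolScAt A B f x) (c : ℂ) :
    HolScAt A B (fun y => c * f y) x := HolScAt.const.mul hf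

open Classical in
/-- Given a divisor of degree `d` and two more local obstructions, a space of sections of dimension
at least `d - 1` contains a section that agrees along the divisor with a combination of the
obstructions, not everything being zero. -/
theorem exists_combination {V : Submodule ℂ (X → ℂ)}
    (hV : ∀ s ∈ V, ∀ x, HolScAt A B s x) (D : Multiset X) (hfin : Module.Finite ℂ V)
    (hdim : D.card < Module.finrank ℂ V + 2) {κ₁ κ₂ : X → X → ℂ}
    (hκ₁ : ∀ x, HolScAt A B (κ₁ x) x) (hκ₂ : ∀ x, HolScAt A B (κ₂ x) x) :
    ∃ s ∈ V, ∃ a b : ℂ, (s, a, b) ≠ 0 ∧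
      ∀ x, (D.count x : ℕ∞) ≤ ordSc A B (fun y => s y + (a * κ₁ x y + b * κ₂ x y)) x := by
  -- the jets along the divisor form a space of dimension `D.card`, too small for `T` to be injective
  let T : (V × ℂ × ℂ) →ₗ[ℂ] (D → ℂ) :=
    { toFun := fun v i => jetSc A B i.2 v.1.1 i.1 +
        (v.2.1 * jetSc A B i.2 (κ₁ i.1) i.1 + v.2.2 * jetSc A B i.2 (κ₂ i.1) i.1)
      map_add' := fun v w => by
        funext i
        have h := jetSc_add (hV _ v.1.2 i.1) (hV _ w.1.2 i.1) i.2
        have h' : jetSc A B i.2 (v.1 + w.1).1 i.1 =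
            jetSc A B i.2 v.1.1 i.1 + jetSc A B i.2 w.1.1 i.1 := h
        simp only [Pi.add_apply, Prod.snd_add, Prod.fst_add, h']
        ring
      map_smul' := fun c v => by
        funext i
        have h := jetSc_const_mul (hV _ v.1.2 i.1) c i.2
        have h' : jetSc A B i.2 (c • v.1).1 i.1 = c * jetSc A B i.2 v.1.1 i.1 := h
        simp only [Pi.smul_apply, Prod.smul_snd, Prod.smul_fst, smul_eq_mul, RingHom.id_apply, h']
        ring }
  have hT : LinearMap.ker T ≠ ⊥ := by
    refine LinearMap.ker_ne_bot_of_finrank_lt ?_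
    rw [Module.finrank_fintype_fun_eq_card, Multiset.card_coe, Module.finrank_prod,
      Module.finrank_prod, Module.finrank_self]
    exact hdim
  obtain ⟨v, hv, hv0⟩ := (Submodule.ne_bot_iff _).1 hT
  refine ⟨v.1.1, v.1.2, v.2.1, v.2.2, fun h => hv0 ?_, fun x => ?_⟩
  · simp only [Prod.mk_eq_zero] at h
    exact Prod.ext (Subtype.ext h.1) (Prod.ext h.2.1 h.2.2)
  · have h1 := (hκ₁ x).const_mul v.2.1
    have h2 := (hκ₂ x).const_mul v.2.2
    rw [ordSc, natCast_le_ordAt_iff_jet ((hV _ v.1.2 x).add (h1.add h2))]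
    intro j hj
    change jetSc A B j _ x = 0
    rw [jetSc_add (hV _ v.1.2 x) (h1.add h2), jetSc_add h1 h2, jetSc_const_mul (hκ₁ x),
      jetSc_const_mul (hκ₂ x)]
    exact congrFun (LinearMap.mem_ker.1 hv) ⟨x, ⟨j, hj⟩⟩

end HolBundle

namespace Extension

variable {L Q : HolLine X} {E₁ E₂ : HolVec X 2} [IsManifold 𝓘(ℂ) ω X]

open Classical in
/-- On a surface of genus two, two nonsplit extensions of `Q` by `L`, with `deg L < deg Q`, whose
classes annihilate the same section with a divisor of degree three are isomorphic bundles. The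
obstructions of both live in the three-dimensional space of sections over the divisor. The global
sections of `K` form a plane in it, which contains neither, so that the two are proportional modulo
this plane. -/
theorem isom_of_annihilates [CompactSpace X] [ConnectedSpace X] (hgenus : genus X = 2)
    (S₁ : Extension L E₁ Q) (S₂ : Extension L E₂ Q) {a b : ℤ} (hL : L.HasDegree a)
    (hQ : Q.HasDegree b) (hab : a < b) {s : X → ℂ}
    (hs : ∀ x, HolScAt L (Q.tensor (canonical X)) s x) {D : Multiset X} (hD : D.card = 3)
    (hsD : ∀ x, ordSc L (Q.tensor (canonical X)) s x = (D.count x : ℕ∞))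
    {φ₁ φ₂ : X → (Fin 2 → ℂ) →L[ℂ] ℂ}
    (hφ₁ : ∀ x, E₁.HolMapAt (Q.tensor (canonical X)) φ₁ x)
    (hφ₂ : ∀ x, E₂.HolMapAt (Q.tensor (canonical X)) φ₂ x)
    (hφs₁ : ∀ x l, φ₁ x (S₁.inc.fib x l) = s x * l)
    (hφs₂ : ∀ x l, φ₂ x (S₂.inc.fib x l) = s x * l)
    (hS₁ : ¬ S₁.Splits) (hS₂ : ¬ S₂.Splits) : E₁.Isom E₂ := by
  have hfinite : ∀ x, ordSc L (Q.tensor (canonical X)) s x ≠ ⊤ := fun x => by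
    rw [hsD]; exact ENat.natCast_ne_top _
  have hsne : ∀ x, ∀ᶠ y in 𝓝[≠] x, s y ≠ 0 := fun x => (hs x).eventually_ne_zero (hfinite x)
  choose σ₁ hσ₁ hp₁ using fun x => exists_local_splitting (S₁.proj.holMapAt x)
    (S₁.proj_surjective x)
  choose σ₂ hσ₂ hp₂ using fun x => exists_local_splitting (S₂.proj.holMapAt x)
    (S₂.proj_surjective x)
  have hκ₁ := fun x => holMapAt_line_iff.1 ((hφ₁ x).comp (hσ₁ x))
  have hκ₂ := fun x => holMapAt_line_iff.1 ((hφ₂ x).comp (hσ₂ x))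
  have hH0 : ∀ t ∈ (canonical X).H0, ∀ x, HolScAt Q (Q.tensor (canonical X)) t x :=
    fun t ht x => (mem_H0_iff.1 ht x).tensor_left
  have hrank : Module.finrank ℂ (canonical X).H0 = 2 := hgenus
  have hfin : Module.Finite ℂ (canonical X).H0 :=
    Module.finite_of_finrank_pos (by rw [hrank]; norm_num)
  obtain ⟨w, hw, α, β, hne, hord⟩ := exists_combination hH0 D hfin (by rw [hrank, hD]; norm_num)
    hκ₁ hκ₂
  simp only [ContinuousLinearMap.comp_apply] at hord hκ₁ hκ₂
  have hloc : ∀ x, ∃ h : X → ℂ, HolScAt Q L h x ∧ ∀ᶠ y in 𝓝 x, s y * h y =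
      w y + (α * φ₁ y (σ₁ x y 1) + β * φ₂ y (σ₂ x y 1)) := fun x =>
    exists_local_quotient_of_ordSc_le (hs x)
      ((hH0 w hw x).add (((hκ₁ x).const_mul α).add ((hκ₂ x).const_mul β))) (hfinite x)
      ((hsD x).trans_le (hord x))
  by_cases hα : α = 0
  · exfalso
    by_cases hβ : β = 0
      -- a section of `K` divisible by `s` is the product of `s` and a map `Q → L`, which is zero
    · obtain ⟨h, hh, hsh⟩ := exists_quotient_of_local (r := w) hsne
        (by simpa [hα, hβ] using hloc)
      refine hne ?_
      have hw0 : w = 0 := by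
        funext x
        rw [← hsh x, eq_zero_of_degree_lt hQ hL hh hab x, mul_zero]
        rfl
      simp [hα, hβ, hw0]
    · refine hS₂ (S₂.splits_of_local hsne hφs₂ (fun y => -β⁻¹ * w y) fun x => ?_)
      obtain ⟨h, hh, hev⟩ := hloc x
      refine ⟨σ₂ x, fun y => -β⁻¹ * h y, hσ₂ x, hh.const_mul _, ?_⟩
      filter_upwards [hp₂ x, hev] with y h1 h2
      refine ⟨h1, ?_⟩
      rw [hα] at h2
      field_simp
      linear_combination -h2
  · by_cases hβ : β = 0
    · exfalso
      refine hS₁ (S₁.splits_of_local hsne hφs₁ (fun y => -α⁻¹ * w y) fun x => ?_)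
      obtain ⟨h, hh, hev⟩ := hloc x
      refine ⟨σ₁ x, fun y => -α⁻¹ * h y, hσ₁ x, hh.const_mul _, ?_⟩
      filter_upwards [hp₁ x, hev] with y h1 h2
      refine ⟨h1, ?_⟩
      rw [hβ] at h2
      field_simp
      linear_combination -h2
    · refine isom_of_local S₁ S₂ hsne hφs₁ hφs₂ (c := -α * β⁻¹)
        (mul_ne_zero (neg_ne_zero.2 hα) (inv_ne_zero hβ)) (fun y => -β⁻¹ * w y) fun x => ?_
      obtain ⟨h, hh, hev⟩ := hloc x
      refine ⟨σ₁ x, σ₂ x, fun y => -β⁻¹ * h y, hσ₁ x, hσ₂ x, hh.const_mul _, ?_⟩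
      filter_upwards [hp₁ x, hp₂ x, hev] with y h1 h2 h3
      refine ⟨h1, h2, ?_⟩
      field_simp
      linear_combination -h3

end Extension

end RealCurve

namespace RealCurve

variable {X : Type u} [TopologicalSpace X] [ChartedSpace ℂ X] [IsManifold 𝓘(ℂ) ω X]

open HolBundle

namespace HolBundle

/-! ### The canonical bundle of a real curve -/

theorem wt_tangent (x y : X) :
    (tangent X).wt x y = deriv (chartAt ℂ y ∘ (chartAt ℂ x).symm) (chartAt ℂ x y) := by
  change fderivWithin ℂ ((chartAt ℂ y).extend 𝓘(ℂ) ∘ ((chartAt ℂ x).extend 𝓘(ℂ)).symm)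
    (Set.range 𝓘(ℂ)) ((chartAt ℂ x).extend 𝓘(ℂ) y) 1 = _
  simp only [mfld_simps]
  rw [fderivWithin_univ, fderiv_apply_one_eq_deriv]

theorem eventually_wt_canonical (x : X) :
    ∀ᶠ y in 𝓝 x, (canonical X).wt x y = ((tangent X).wt x y)⁻¹ :=
  (tangent X).eventually_wt_dual x

theorem holAt_chartAt (x : X) : HolAt (chartAt ℂ x) x :=
  contMDiffOn_chart.contMDiffAt ((chartAt ℂ x).open_source.mem_nhds (mem_chart_source ℂ x))

theorem differentiableAt_transition {x y : X} (hy : y ∈ (chartAt ℂ x).source) :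
    DifferentiableAt ℂ (chartAt ℂ y ∘ (chartAt ℂ x).symm) (chartAt ℂ x y) := by
  have h1 : ContMDiffAt 𝓘(ℂ) 𝓘(ℂ) ω (chartAt ℂ x).symm (chartAt ℂ x y) :=
    contMDiffOn_chart_symm.contMDiffAt
      ((chartAt ℂ x).open_target.mem_nhds ((chartAt ℂ x).map_source hy))
  have h2 : HolAt (chartAt ℂ y) ((chartAt ℂ x).symm (chartAt ℂ x y)) := by
    rw [(chartAt ℂ x).left_inv hy]
    exact holAt_chartAt y
  have h3 : ContMDiffAt 𝓘(ℂ) 𝓘(ℂ) ω (chartAt ℂ y ∘ (chartAt ℂ x).symm) (chartAt ℂ x y) :=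
    ContMDiffAt.comp _ h2 h1
  exact h3.contDiffAt.differentiableAt (by simp)

/-- The chain rule for the derivative of the involution under changes of coordinates. -/
theorem eventually_deriv_coord (τ : RealStructure X) (x : X) :
    ∀ᶠ y in 𝓝 x, conj ((tangent X).wt (τ.toFun x) (τ.toFun y)) *
        deriv (τ.coord x) (chartAt ℂ x y) =
      deriv (τ.coord y) (chartAt ℂ y y) * (tangent X).wt x y := by
  have hτ : ∀ᶠ y in 𝓝 x, τ.toFun y ∈ (chartAt ℂ (τ.toFun x)).source :=
    τ.eventually_comp (eventually_mem_chart_source _)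
  have hdiff : ∀ᶠ y in 𝓝 x, DifferentiableAt ℂ (τ.coord x) (chartAt ℂ x y) := by
    have h1 : ∀ᶠ z in 𝓝 (chartAt ℂ x x), AnalyticAt ℂ (τ.coord x) z :=
      (τ.analyticAt_coord x).eventually_analyticAt
    exact (((chartAt ℂ x).continuousAt (mem_chart_source ℂ x)).eventually h1).mono
      fun y hy => hy.differentiableAt
  filter_upwards [hτ.eventually_nhds, eventually_mem_chart_source x, hdiff] with y hy hyx hd
  have hsymm : (chartAt ℂ x).symm (chartAt ℂ x y) = y := (chartAt ℂ x).left_inv hyx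
  have hτy := hy.self_of_nhds
  have hc : τ.coord x (chartAt ℂ x y) = conj (chartAt ℂ (τ.toFun x) (τ.toFun y)) := by
    rw [RealStructure.coord, hsymm]
  -- the left-hand side is the derivative of the transition around `τ x`, conjugated, after `τ`
  have h1 : HasDerivAt (fun z => conj ((chartAt ℂ (τ.toFun y) ∘ (chartAt ℂ (τ.toFun x)).symm)
      (conj (τ.coord x z))))
      (conj ((tangent X).wt (τ.toFun x) (τ.toFun y)) * deriv (τ.coord x) (chartAt ℂ x y))
      (chartAt ℂ x y) := by
    have h2 := (differentiableAt_transition hτy).hasDerivAt.conj_conj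
    rw [← hc, ← wt_tangent] at h2
    exact HasDerivAt.comp (h₂ := conj ∘ (chartAt ℂ (τ.toFun y) ∘
      (chartAt ℂ (τ.toFun x)).symm) ∘ conj) _ h2 hd.hasDerivAt
  -- the right-hand side is the derivative of `τ` after the transition around `x`
  have h3 : HasDerivAt (τ.coord y ∘ (chartAt ℂ y ∘ (chartAt ℂ x).symm))
      (deriv (τ.coord y) (chartAt ℂ y y) * (tangent X).wt x y) (chartAt ℂ x y) := by
    have h4 := (differentiableAt_transition hyx).hasDerivAt
    rw [← wt_tangent] at h4
    refine HasDerivAt.comp _ ?_ h4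
    simp only [Function.comp_apply, hsymm]
    exact (τ.analyticAt_coord y).differentiableAt.hasDerivAt
  refine h1.unique (h3.congr_of_eventuallyEq ?_)
  have hcont : Filter.Tendsto (chartAt ℂ x).symm (𝓝 (chartAt ℂ x y)) (𝓝 y) := by
    have := (chartAt ℂ x).continuousAt_symm ((chartAt ℂ x).map_source hyx)
    rwa [ContinuousAt, hsymm] at this
  filter_upwards [hcont.eventually hy, hcont.eventually (eventually_mem_chart_source y)]
    with z hz hz'
  simp only [Function.comp_apply, RealStructure.coord, Complex.conj_conj]
  rw [(chartAt ℂ (τ.toFun x)).left_inv hz, (chartAt ℂ y).left_inv hz']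

/-- The derivative of the involution identifies the conjugate of the canonical bundle with the
canonical bundle. -/
theorem exists_conjPullback_canonical (τ : RealStructure X) :
    ∃ κ : X → ℂ, (∀ x, HolScAt ((canonical X).conjPullback τ) (canonical X) κ x) ∧
      ∀ x, κ x ≠ 0 := by
  refine ⟨fun y => deriv (τ.coord y) (chartAt ℂ y y), fun x => ?_, τ.deriv_coord_ne_zero⟩
  refine ContMDiffAt.congr_of_eventuallyEq
    (HolAt.comp_chart (τ.analyticAt_coord x).deriv) ?_
  filter_upwards [eventually_deriv_coord τ x, eventually_wt_canonical x,
    (tangent X).eventually_wt_ne_zero x, τ.eventually_comp (eventually_wt_canonical (τ.toFun x)),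
    τ.eventually_comp ((tangent X).eventually_wt_ne_zero (τ.toFun x))] with y h1 h2 h3 h4 h5
  have h6 : conj ((tangent X).wt (τ.toFun x) (τ.toFun y)) ≠ 0 := by simpa using h5
  rw [wt_conjPullback, h2, h4, map_inv₀, inv_inv]
  field_simp
  linear_combination -h1

end HolBundle

end RealCurve

namespace RealCurve

variable {X : Type u} [TopologicalSpace X] [ChartedSpace ℂ X]
  {F : Type} [NormedAddCommGroup F] [NormedSpace ℂ F]
  {F' : Type} [NormedAddCommGroup F'] [NormedSpace ℂ F']

open HolBundle

/-! ### Invariant divisors -/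

open Classical in
theorem RealStructure.map_eq_iff_count (τ : RealStructure X) {n : ℕ} (D : Sym X n) :
    D.map τ.toFun = D ↔
      ∀ x, (D : Multiset X).count (τ.toFun x) = (D : Multiset X).count x := by
  have key : ∀ x, ((D.map τ.toFun : Sym X n) : Multiset X).count (τ.toFun x) =
      (D : Multiset X).count x := fun x => by
    rw [Sym.coe_map]
    exact Multiset.count_map_eq_count' _ _ τ.involutive.injective _
  constructor
  · intro h x
    rw [← key x, h]
  · intro h
    refine Sym.coe_injective (Multiset.ext.2 fun x => ?_)
    rw [← τ.apply_apply x, key, h, τ.apply_apply]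

/-! ### Twisting and conjugating extensions -/

/-- The complex conjugate `v ↦ star (A (star v))` of a linear map `A : F → F'`. -/
def conjMap [StarAddMonoid F] [StarModule ℂ F] [ContinuousStar F] [StarAddMonoid F']
    [StarModule ℂ F'] [ContinuousStar F'] (A : F →L[ℂ] F') : F →L[ℂ] F' :=
  ((starL ℂ : F' ≃L⋆[ℂ] F') : F' →L⋆[ℂ] F').comp
    (A.comp ((starL ℂ : F ≃L⋆[ℂ] F) : F →L⋆[ℂ] F))

namespace HolBundle

theorem holMapAt_dual_tensor_tensor (A : HolLine X) (E : HolBundle X F) (x : X) :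
    (A.dual.tensor (A.tensor E)).HolMapAt E (fun _ => ContinuousLinearMap.id ℂ F) x := by
  refine ContMDiffAt.congr_of_eventuallyEq (HolMapAt.id (E := E) (x := x)) ?_
  filter_upwards [A.eventually_wt_ne_zero x, A.eventually_wt_dual x] with y h0 hd
  ext1 v
  simp [readMap, frame_tensor, hd, smul_smul, h0]

end HolBundle

namespace Extension

variable {L L' Q Q' : HolLine X} {E E' : HolVec X 2}

/-- The tensor product of an extension with a line bundle `A`, after identifications of the middle
term `E'` with `E`, of `A ⊗ L'` with `L` and of `A ⊗ Q'` with `Q`. -/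
def twist (S : Extension L' E' Q') (A : HolLine X) (f : E'.Map E) (g : E.Map E')
    (hfg : ∀ x, (∀ v, g.fib x (f.fib x v) = v) ∧ ∀ w, f.fib x (g.fib x w) = w)
    {α β : X → ℂ} (hα : ∀ x, HolScAt L (A.tensor L') α x) (hα0 : ∀ x, α x ≠ 0)
    (hβ : ∀ x, HolScAt (A.tensor Q') Q β x) (hβ0 : ∀ x, β x ≠ 0) :
    Extension L (A.tensor E) Q where
  inc := Map.ofHolMapAt (fun y => α y • (f.fib y).comp (S.inc.fib y)) fun x => by
    refine (((HolMapAt.tensor (HolScAt.const (A := A) (c := 1))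
      ((f.holMapAt x).comp (S.inc.holMapAt x))).comp (holMapAt_sc_iff.2 (hα x)))).congr
      (.of_forall fun y => ?_)
    ext1
    simp [clm_apply_eq_smul (S.inc.fib y) (α y)]
  proj := Map.ofHolMapAt (fun y => β y • (S.proj.fib y).comp (g.fib y)) fun x => by
    refine ((holMapAt_sc_iff.2 (hβ x)).comp (HolMapAt.tensor (HolScAt.const (A := A) (c := 1))
      ((S.proj.holMapAt x).comp (g.holMapAt x)))).congr (.of_forall fun y => ?_)
    ext1 v
    simp
  inc_injective x := by
    intro l l' h
    have h1 : α x • f.fib x (S.inc.fib x l) = α x • f.fib x (S.inc.fib x l') := h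
    have h2 := congrArg (g.fib x) ((smul_right_inj (hα0 x)).1 h1)
    rw [(hfg x).1, (hfg x).1] at h2
    exact S.inc_injective x h2
  proj_surjective x q := by
    obtain ⟨v, hv⟩ := S.proj_surjective x ((β x)⁻¹ * q)
    refine ⟨f.fib x v, ?_⟩
    change β x • S.proj.fib x (g.fib x (f.fib x v)) = q
    rw [(hfg x).1, hv, smul_eq_mul, mul_inv_cancel_left₀ (hβ0 x)]
  exact x v := by
    change β x • S.proj.fib x (g.fib x v) = 0 ↔ ∃ l, α x • f.fib x (S.inc.fib x l) = v
    rw [smul_eq_zero_iff_right (hβ0 x), S.exact]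
    constructor
    · rintro ⟨l, hl⟩
      refine ⟨(α x)⁻¹ * l, ?_⟩
      rw [← smul_eq_mul, map_smul, map_smul, smul_inv_smul₀ (hα0 x), hl, (hfg x).2]
    · rintro ⟨l, rfl⟩
      exact ⟨α x * l, by rw [map_smul, (hfg x).1, ← smul_eq_mul, map_smul]⟩

theorem Splits.of_twist (S : Extension L' E' Q') (A : HolLine X) (f : E'.Map E) (g : E.Map E')
    (hfg : ∀ x, (∀ v, g.fib x (f.fib x v) = v) ∧ ∀ w, f.fib x (g.fib x w) = w)
    {α β : X → ℂ} (hα : ∀ x, HolScAt L (A.tensor L') α x) (hα0 : ∀ x, α x ≠ 0)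
    (hβ : ∀ x, HolScAt (A.tensor Q') Q β x) (hβ0 : ∀ x, β x ≠ 0)
    (h : (S.twist A f g hfg hα hα0 hβ hβ0).Splits) :
    S.Splits := by
  obtain ⟨σ, hσ, hp⟩ := h
  refine ⟨fun y => (g.fib y).comp ((σ y).comp (sc β y)), fun x => ?_, fun x q => ?_⟩
  · have h1 : Q'.HolMapAt (A.dual.tensor (A.tensor Q')) (sc fun _ => 1) x := by
      rw [holMapAt_sc_iff]
      refine (HolScAt.const (A := Q') (c := 1)).of_wt ?_
      filter_upwards [A.eventually_wt_ne_zero x, A.eventually_wt_dual x] with y h0 hd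
      rw [wt_tensor, wt_tensor, hd]
      field_simp
    have h2 : (A.dual.tensor (A.tensor Q')).HolMapAt (A.dual.tensor (A.tensor E))
        (fun y => (1 : ℂ) • (σ y).comp (sc β y)) x :=
      HolMapAt.tensor HolScAt.const ((hσ x).comp (holMapAt_sc_iff.2 (hβ x)))
    refine ((g.holMapAt x).comp ((holMapAt_dual_tensor_tensor A E x).comp (h2.comp h1))).congr
      (.of_forall fun y => ?_)
    ext1
    simp
  · have h1 : β x • S.proj.fib x (g.fib x (σ x (β x * q))) = β x * q := hp x (β x * q)
    exact mul_left_cancel₀ (hβ0 x) h1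

section Conj

variable [IsManifold 𝓘(ℂ) ω X] (τ : RealStructure X)

/-- The conjugate of an extension `0 → L → E → Q → 0`. -/
def conjPullback (S : Extension L E Q) :
    Extension (L.conjPullback τ) (E.conjPullback τ) (Q.conjPullback τ) where
  inc := Map.ofHolMapAt (fun y => conjMap (S.inc.fib (τ.toFun y))) fun x =>
    HolMapAt.conjPullback τ (S.inc.holMapAt _) fun _ _ => rfl
  proj := Map.ofHolMapAt (fun y => conjMap (S.proj.fib (τ.toFun y))) fun x =>
    HolMapAt.conjPullback τ (S.proj.holMapAt _) fun _ _ => rfl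
  inc_injective x := star_injective.comp ((S.inc_injective _).comp star_injective)
  proj_surjective x :=
    star_involutive.surjective.comp ((S.proj_surjective _).comp star_involutive.surjective)
  exact x v := by
    change star (S.proj.fib (τ.toFun x) (star v)) = 0 ↔
      ∃ l, star (S.inc.fib (τ.toFun x) (star l)) = v
    rw [star_eq_zero, S.exact]
    constructor
    · rintro ⟨l, hl⟩
      exact ⟨star l, by rw [star_star, hl, star_star]⟩
    · rintro ⟨l, rfl⟩
      exact ⟨star l, by rw [star_star]⟩

theorem Splits.of_conjPullback {S : Extension L E Q} (h : (S.conjPullback τ).Splits) :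
    S.Splits := by
  obtain ⟨σ, hσ, hp⟩ := h
  refine ⟨fun y => conjMap (σ (τ.toFun y)), fun x => ?_, fun x q => ?_⟩
  · exact (holMapAt_conjPullback_conjPullback τ).1
      (HolMapAt.conjPullback τ (hσ _) fun _ _ => rfl)
  · have h1 : star (S.proj.fib (τ.toFun (τ.toFun x)) (star (σ (τ.toFun x) (star q)))) = star q :=
      hp (τ.toFun x) (star q)
    rw [τ.apply_apply] at h1
    exact star_injective h1

end Conj

end Extension

end RealCurve

namespace RealCurve

open HolBundle Extension

variable {X : Type u} [TopologicalSpace X] [CompactSpace X] [ConnectedSpace X]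
  [ChartedSpace ℂ X] [IsManifold 𝓘(ℂ) ω X]
  {Λ L : HolLine X} {E : HolVec X 2}

/-! ### Reality of the subbundle and of the divisor -/

open Classical in
/-- If the subbundle is real, so is the divisor: the conjugate inclusion `L → E` is a multiple of
the given one, so that conjugation maps the line of annihilated sections to itself. -/
theorem count_eq_of_isReal (τ : RealStructure X) (hΛreal : Λ.IsReal τ) (hEreal : E.IsReal τ)
    (hLreal : L.IsReal τ) (hLdeg : L.HasDegree 0) (hQdeg : (L.dual.tensor Λ).HasDegree 1)
    (S : Extension L E (L.dual.tensor Λ)) (hS : ¬ S.Splits) {D : Multiset X} {s : X → ℂ}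
    (hs : ∀ x, HolScAt L ((L.dual.tensor Λ).tensor (canonical X)) s x)
    (hline : ∀ t ∈ (serreDualLine L (L.dual.tensor Λ)).H0, S.Annihilates t ↔ ∃ z : ℂ, t = z • s)
    (hann : S.Annihilates s)
    (hsD : ∀ x, ordSc L ((L.dual.tensor Λ).tensor (canonical X)) s x = (D.count x : ℕ∞)) (x : X) :
    D.count (τ.toFun x) = D.count x := by
  obtain ⟨φ, hφ, hφs⟩ := hann.exists_map hs
  obtain ⟨f, g, hfg⟩ := hEreal
  obtain ⟨β, hβ, hβ0⟩ := isom_iff_exists_scalar.1 hLreal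
  obtain ⟨l, hl, hl0⟩ := isom_iff_exists_scalar.1 hΛreal
  obtain ⟨κ, hκ, hκ0⟩ := exists_conjPullback_canonical τ
  have hβi : ∀ x, HolScAt L (L.conjPullback τ) (fun y => (β y)⁻¹) x := fun x =>
    (hβ x).inv (hβ0 x)
  -- the identification of the conjugate of `L⁻¹ ⊗ Λ ⊗ K` with `L⁻¹ ⊗ Λ ⊗ K`
  have hn : ∀ x, HolScAt (((L.dual.tensor Λ).tensor (canonical X)).conjPullback τ)
      ((L.dual.tensor Λ).tensor (canonical X)) (fun y => (β y)⁻¹ * l y * κ y) x := fun x => by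
    refine (((hβi x).tensor (hl x)).tensor (hκ x)).of_wt ?_
    filter_upwards [L.eventually_wt_ne_zero x, L.eventually_wt_dual x,
      τ.eventually_comp (L.eventually_wt_ne_zero (τ.toFun x)),
      τ.eventually_comp (L.eventually_wt_dual (τ.toFun x))] with y h1 h2 h3 h4
    have h5 : conj (L.wt (τ.toFun x) (τ.toFun y)) ≠ 0 := by simpa using h3
    simp only [wt_tensor, wt_conjPullback, h2, h4, map_mul, map_inv₀]
    field_simp
  obtain ⟨c, hc⟩ := S.exists_eq_smul_inc hLdeg hQdeg hS (g := fun y =>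
    (f.fib y).comp (((S.conjPullback τ).inc.fib y).comp (sc (fun y => (β y)⁻¹) y))) fun x =>
      (f.holMapAt x).comp (((S.conjPullback τ).inc.holMapAt x).comp (holMapAt_sc_iff.2 (hβi x)))
  have hc0 : c ≠ 0 := by
    rintro rfl
    have h1 : f.fib x ((S.conjPullback τ).inc.fib x ((β x)⁻¹ * 1)) = 0 := by
      simpa using congrArg (fun φ : ℂ →L[ℂ] (Fin 2 → ℂ) => φ 1) (hc x)
    have h2 := congrArg (g.fib x) h1
    rw [(hfg x).1, map_zero] at h2
    have h3 := (S.conjPullback τ).inc_injective x (h2.trans (map_zero _).symm)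
    exact hβ0 x (by simpa using h3)
  set t : X → ℂ := fun y => (c⁻¹ * ((β y)⁻¹ * l y * κ y)) * (conj (s (τ.toFun y)) * (β y)⁻¹)
    with ht
  have hn' : ∀ x, HolScAt (((L.dual.tensor Λ).tensor (canonical X)).conjPullback τ)
      ((L.dual.tensor Λ).tensor (canonical X)) (fun y => c⁻¹ * ((β y)⁻¹ * l y * κ y)) x :=
    fun x => (hn x).const_mul _
  have hs' : ∀ x, HolScAt (L.conjPullback τ)
      (((L.dual.tensor Λ).tensor (canonical X)).conjPullback τ)
      (fun y => conj (s (τ.toFun y))) x := fun x => (hs (τ.toFun x)).conjPullback τ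
  have hthol : ∀ x, HolScAt L ((L.dual.tensor Λ).tensor (canonical X)) t x := fun x =>
    (hn' x).mul ((hs' x).mul (hβi x))
  have htord : ordSc L ((L.dual.tensor Λ).tensor (canonical X)) t x =
      (D.count (τ.toFun x) : ℕ∞) := by
    rw [ht, ordSc_mul (hn' x) ((hs' x).mul (hβi x)), ordSc_mul (hs' x) (hβi x),
      ordSc_conjPullback τ (hs (τ.toFun x)), hsD,
      (hn' x).ordSc_eq_zero.2 (by simp [hc0, hβ0 x, hl0 x, hκ0 x]),
      (hβi x).ordSc_eq_zero.2 (inv_ne_zero (hβ0 x)), zero_add, add_zero]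
  -- the conjugate of `φ` extends `t`
  have htann : S.Annihilates t := by
    refine annihilates_of_map hann (φ := fun y => (sc (fun y => (β y)⁻¹ * l y * κ y) y).comp
      ((conjMap (φ (τ.toFun y))).comp (g.fib y))) (fun x => (holMapAt_sc_iff.2 (hn x)).comp
        ((HolMapAt.conjPullback τ (hφ (τ.toFun x)) fun _ _ => rfl).comp (g.holMapAt x)))
      fun y v => ?_
    have h1 : S.inc.fib y v =
        f.fib y ((S.conjPullback τ).inc.fib y ((β y)⁻¹ * (c⁻¹ * v))) := by
      have := congrArg (fun φ : ℂ →L[ℂ] (Fin 2 → ℂ) => φ (c⁻¹ * v)) (hc y)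
      simp only [ContinuousLinearMap.comp_apply, sc_apply, smul_apply] at this
      rw [this, ← map_smul, smul_eq_mul, mul_inv_cancel_left₀ hc0]
    have h2 : ∀ w, conjMap (φ (τ.toFun y)) ((S.conjPullback τ).inc.fib y w) =
        conj (s (τ.toFun y)) * w := fun w => by
      change star (φ (τ.toFun y) (star (star (S.inc.fib (τ.toFun y) (star w))))) = _
      rw [star_star, hφs, star_mul', star_star]
      rfl
    rw [ContinuousLinearMap.comp_apply, ContinuousLinearMap.comp_apply, h1, (hfg y).1, h2, sc_apply]
    simp only [ht]
    ring
  obtain ⟨z, hz⟩ := (hline t (mem_H0_iff.2 fun x =>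
    holScAt_serreDualLine_iff.2 (hthol x))).1 htann
  have hz0 : z ≠ 0 := by
    rintro rfl
    have h1 : ordSc L ((L.dual.tensor Λ).tensor (canonical X)) t x = ⊤ :=
      ordSc_eq_top.2 (.of_forall fun y => by rw [hz, zero_smul]; rfl)
    rw [htord] at h1
    exact ENat.natCast_ne_top _ h1
  have h1 : ordSc L ((L.dual.tensor Λ).tensor (canonical X)) t x = (D.count x : ℕ∞) := by
    have h2 : t = fun y => z * s y := hz
    rw [h2, ordSc_const_mul (hs x) hz0, hsD]
  rw [htord] at h1
  exact_mod_cast h1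

open Classical in
/-- If the divisor is real, so is the subbundle: the conjugate subbundle `L'` satisfies `L'² ≅ L²`,
and after twisting by the square root `L'⁻¹ ⊗ L` of the trivial bundle both extensions annihilate
the same section, so that their middle terms `E` and `L'⁻¹ ⊗ L ⊗ E` are isomorphic. -/
theorem isReal_of_count_eq (hgenus : genus X = 2) (τ : RealStructure X) (hΛreal : Λ.IsReal τ)
    (hEreal : E.IsReal τ)
    (hEgen : ∀ L₀ : HolLine X, (L₀.tensor L₀).Isom (HolBundle.trivialLine X) →
      ¬ L₀.Isom (HolBundle.trivialLine X) → ¬ (L₀.tensor E).Isom E)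
    (hLdeg : L.HasDegree 0) (hQdeg : (L.dual.tensor Λ).HasDegree 1)
    (S : Extension L E (L.dual.tensor Λ)) (hS : ¬ S.Splits) {D : Multiset X} (hD : D.card = 3)
    {s : X → ℂ} (hs : ∀ x, HolScAt L ((L.dual.tensor Λ).tensor (canonical X)) s x)
    (hann : S.Annihilates s)
    (hsD : ∀ x, ordSc L ((L.dual.tensor Λ).tensor (canonical X)) s x = (D.count x : ℕ∞))
    (hreal : ∀ x, D.count (τ.toFun x) = D.count x) : L.IsReal τ := by
  obtain ⟨φ, hφ, hφs⟩ := hann.exists_map hs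
  obtain ⟨f, g, hfg⟩ := hEreal
  obtain ⟨l, hl, hl0⟩ := isom_iff_exists_scalar.1 hΛreal
  obtain ⟨κ, hκ, hκ0⟩ := exists_conjPullback_canonical τ
  have hconj : ∀ x, ∀ᶠ y in 𝓝 x, L.wt x y ≠ 0 ∧ L.dual.wt x y = (L.wt x y)⁻¹ ∧
      conj (L.wt (τ.toFun x) (τ.toFun y)) ≠ 0 ∧
      conj (L.dual.wt (τ.toFun x) (τ.toFun y)) = (conj (L.wt (τ.toFun x) (τ.toFun y)))⁻¹ ∧
      (L.conjPullback τ).dual.wt x y = (conj (L.wt (τ.toFun x) (τ.toFun y)))⁻¹ := by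
    intro x
    filter_upwards [L.eventually_wt_ne_zero x, L.eventually_wt_dual x,
      τ.eventually_comp (L.eventually_wt_ne_zero (τ.toFun x)),
      τ.eventually_comp (L.eventually_wt_dual (τ.toFun x)),
      (L.conjPullback τ).eventually_wt_dual x] with y h1 h2 h3 h4 h5
    refine ⟨h1, h2, by simpa using h3, by rw [h4, map_inv₀], by rw [h5, wt_conjPullback]⟩
  -- both sections, as maps from the squares of the subbundles to `Λ ⊗ K`
  have hs₁ : ∀ x, HolScAt (L.tensor L) (Λ.tensor (canonical X)) s x := fun x => by
    refine (hs x).of_wt ?_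
    filter_upwards [hconj x] with y ⟨h1, h2, _⟩
    simp only [wt_tensor, h2]
    field_simp
  have hord₁ : ∀ x, ordSc (L.tensor L) (Λ.tensor (canonical X)) s x = (D.count x : ℕ∞) :=
    fun x => by
    rw [← hsD]
    refine ordSc_of_wt ?_
    filter_upwards [hconj x] with y ⟨h1, h2, _⟩
    simp only [wt_tensor, h2]
    field_simp
  have hlκ : ∀ x, HolScAt ((Λ.conjPullback τ).tensor ((canonical X).conjPullback τ))
      (Λ.tensor (canonical X)) (fun y => l y * κ y) x := fun x => (hl x).tensor (hκ x)
  have hs' : ∀ x, HolScAt (L.conjPullback τ)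
      (((L.dual.tensor Λ).tensor (canonical X)).conjPullback τ)
      (fun y => conj (s (τ.toFun y))) x := fun x => (hs (τ.toFun x)).conjPullback τ
  have hs₂ : ∀ x, HolScAt ((L.conjPullback τ).tensor (L.conjPullback τ))
      ((Λ.conjPullback τ).tensor ((canonical X).conjPullback τ))
      (fun y => conj (s (τ.toFun y))) x := fun x => by
    refine (hs' x).of_wt ?_
    filter_upwards [hconj x] with y ⟨_, _, h3, h4, _⟩
    simp only [wt_tensor, wt_conjPullback, h4, map_mul]
    field_simp
  have hord₂ : ∀ x, ordSc ((L.conjPullback τ).tensor (L.conjPullback τ))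
      ((Λ.conjPullback τ).tensor ((canonical X).conjPullback τ))
      (fun y => conj (s (τ.toFun y))) x = (D.count x : ℕ∞) := fun x => by
    rw [← hreal, ← hsD, ← ordSc_conjPullback τ (hs (τ.toFun x))]
    refine ordSc_of_wt ?_
    filter_upwards [hconj x] with y ⟨_, _, h3, h4, _⟩
    simp only [wt_tensor, wt_conjPullback, h4, map_mul]
    field_simp
  have hlκ0 : ∀ x, l x * κ x ≠ 0 := fun x => mul_ne_zero (hl0 x) (hκ0 x)
  have hord₃ : ∀ x, ordSc ((L.conjPullback τ).tensor (L.conjPullback τ)) (Λ.tensor (canonical X))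
      (fun y => l y * κ y * conj (s (τ.toFun y))) x = (D.count x : ℕ∞) := fun x => by
    rw [ordSc_mul (hlκ x) (hs₂ x), (hlκ x).ordSc_eq_zero.2 (hlκ0 x), hord₂, zero_add]
  have htop : ∀ x, ordSc (L.tensor L) (Λ.tensor (canonical X)) s x ≠ ⊤ := fun x => by
    rw [hord₁]; exact ENat.natCast_ne_top _
  -- the ratio of the two sections identifies the squares
  obtain ⟨u, hu, hsu⟩ := exists_quotient_of_local (fun x => (hs₁ x).eventually_ne_zero (htop x))
    fun x => exists_local_quotient_of_ordSc_le (hs₁ x) ((hlκ x).mul (hs₂ x)) (htop x)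
      (((hord₁ x).trans (hord₃ x).symm).le)
  have hu0 : ∀ x, u x ≠ 0 := fun x => by
    rw [← (hu x).ordSc_eq_zero]
    have h1 := ordSc_mul (hs₁ x) (hu x)
    simp only [hsu] at h1
    rw [hord₃, hord₁] at h1
    exact ENat.add_right_injective_of_ne_top (ENat.natCast_ne_top _)
      (h1.symm.trans (add_zero _).symm)
  set L₀ : HolLine X := (L.conjPullback τ).dual.tensor L with hL₀
  have hsq : (L₀.tensor L₀).Isom (trivialLine X) := by
    refine isom_iff_exists_scalar.2 ⟨fun y => (u y)⁻¹, fun x => ?_, fun x => inv_ne_zero (hu0 x)⟩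
    refine ((hu x).inv (hu0 x)).of_wt ?_
    filter_upwards [hconj x] with y ⟨_, _, h3, _, h5⟩
    simp only [hL₀, wt_tensor, wt_trivialLine, wt_conjPullback, h5]
    field_simp
  have hα : ∀ x, HolScAt L (L₀.tensor (L.conjPullback τ)) (fun _ => 1) x := fun x => by
    refine (HolScAt.const (A := L) (c := 1)).of_wt ?_
    filter_upwards [hconj x] with y ⟨h1, _, h3, _, h5⟩
    simp only [hL₀, wt_tensor, wt_conjPullback, h5]
    field_simp
  have hβ : ∀ x, HolScAt (L₀.tensor ((L.dual.tensor Λ).conjPullback τ)) (L.dual.tensor Λ)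
      (fun y => (u y)⁻¹ * l y) x := fun x => by
    refine (((hu x).inv (hu0 x)).tensor (hl x)).of_wt ?_
    filter_upwards [hconj x] with y ⟨h1, h2, h3, h4, h5⟩
    simp only [hL₀, wt_tensor, wt_conjPullback, h2, h4, h5, map_mul]
    field_simp
  have hγ : ∀ x, HolScAt (L₀.tensor (((L.dual.tensor Λ).tensor (canonical X)).conjPullback τ))
      ((L.dual.tensor Λ).tensor (canonical X)) (fun y => (u y)⁻¹ * (l y * κ y)) x := fun x => by
    refine (((hu x).inv (hu0 x)).tensor (hlκ x)).of_wt ?_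
    filter_upwards [hconj x] with y ⟨h1, h2, h3, h4, h5⟩
    simp only [hL₀, wt_tensor, wt_conjPullback, h2, h4, h5, map_mul]
    field_simp
  have hβ0 : ∀ x, (u x)⁻¹ * l x ≠ 0 := fun x => mul_ne_zero (inv_ne_zero (hu0 x)) (hl0 x)
  let S₂ : Extension L (L₀.tensor E) (L.dual.tensor Λ) :=
    (S.conjPullback τ).twist L₀ f g hfg hα (fun _ => one_ne_zero) hβ hβ0
  have hS₂ : ¬ S₂.Splits := fun h =>
    hS (Splits.of_conjPullback τ (Splits.of_twist _ _ _ _ _ _ _ _ _ h))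
  have hφ₂ : ∀ x, (L₀.tensor E).HolMapAt ((L.dual.tensor Λ).tensor (canonical X))
      (fun y => (sc (fun y => (u y)⁻¹ * (l y * κ y)) y).comp
        ((1 : ℂ) • (conjMap (φ (τ.toFun y))).comp (g.fib y))) x := fun x =>
    (holMapAt_sc_iff.2 (hγ x)).comp (HolMapAt.tensor HolScAt.const
      ((HolMapAt.conjPullback τ (hφ (τ.toFun x)) fun _ _ => rfl).comp (g.holMapAt x)))
  have hφs₂ : ∀ x v, (sc (fun y => (u y)⁻¹ * (l y * κ y)) x).comp
        ((1 : ℂ) • (conjMap (φ (τ.toFun x))).comp (g.fib x)) (S₂.inc.fib x v) = s x * v := by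
    intro x v
    have h1 : S₂.inc.fib x v = f.fib x ((S.conjPullback τ).inc.fib x v) :=
      one_smul ℂ (f.fib x ((S.conjPullback τ).inc.fib x v))
    have h2 : conjMap (φ (τ.toFun x)) ((S.conjPullback τ).inc.fib x v) =
        conj (s (τ.toFun x)) * v := by
      change star (φ (τ.toFun x) (star (star (S.inc.fib (τ.toFun x) (star v))))) = _
      rw [star_star, hφs, star_mul', star_star]
      rfl
    rw [h1, one_smul, ContinuousLinearMap.comp_apply, ContinuousLinearMap.comp_apply, (hfg x).1, h2,
      sc_apply]
    have h3 := hsu x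
    have h4 := hu0 x
    field_simp
    linear_combination -v * h3
  have hiso : (L₀.tensor E).Isom E :=
    isom_of_annihilates hgenus S₂ S hLdeg hQdeg zero_lt_one hs hD hsD hφ₂ hφ hφs₂ hφs hS₂ hS
  obtain ⟨v, hv, hv0⟩ := isom_iff_exists_scalar.1
    (not_not.1 fun h => hEgen L₀ hsq h hiso)
  refine isom_iff_exists_scalar.2 ⟨fun y => (v y)⁻¹, fun x => ?_, fun x => inv_ne_zero (hv0 x)⟩
  refine ((hv x).inv (hv0 x)).of_wt ?_
  filter_upwards [hconj x] with y ⟨h1, _, h3, _, h5⟩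
  simp only [hL₀, wt_tensor, wt_trivialLine, wt_conjPullback, h5]
  field_simp

end RealCurve

end

theorem mainTheorem6 {X : Type u} [TopologicalSpace X] [T2Space X] [CompactSpace X]
    [ConnectedSpace X] [ChartedSpace ℂ X] [IsManifold 𝓘(ℂ) ω X] (hgenus : genus X = 2)
    (τ : RealStructure X)
    (Λ : HolLine X) (hΛdeg : Λ.HasDegree 1) (hΛreal : Λ.IsReal τ)
    (E : HolVec X 2) (hEss : E.IsSemistable) (hEdet : E.det.Isom Λ) (hEreal : E.IsReal τ)
    (hEgen : ∀ L₀ : HolLine X, (L₀.tensor L₀).Isom (HolBundle.trivialLine X) →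
      ¬ L₀.Isom (HolBundle.trivialLine X) → ¬ (L₀.tensor E).Isom E)
    (L : HolLine X) (hLdeg : L.HasDegree 0) (S : Extension L E (L.dual.tensor Λ))
    (D : Sym X 3) (hD : S.IsAssociatedDivisor D) :
    L.IsReal τ ↔ D.map τ.toFun = D := by
  classical
  obtain ⟨s, hsH0, hline, hsD⟩ := hD
  have hs : ∀ x,
      HolBundle.HolScAt L ((L.dual.tensor Λ).tensor (HolBundle.canonical X)) s x := fun x =>
    HolBundle.holScAt_serreDualLine_iff.1 (HolBundle.mem_H0_iff.1 hsH0 x)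
  have hann : S.Annihilates s := (hline s hsH0).2 ⟨1, (one_smul ℂ s).symm⟩
  have hsD' : ∀ x, HolBundle.ordSc L ((L.dual.tensor Λ).tensor (HolBundle.canonical X)) s x =
      ((D : Multiset X).count x : ℕ∞) := fun x => by
    rw [← HolBundle.ordSc_serreDualLine, ← HolBundle.vanishingOrder_eq, hsD x]
  have hQdeg : (L.dual.tensor Λ).HasDegree 1 := by simpa using hLdeg.dual.tensor hΛdeg
  have hS : ¬ S.Splits := S.not_splits hEss hQdeg (hΛdeg.of_isom hEdet)
  rw [τ.map_eq_iff_count]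
  constructor
  · intro h x
    have := count_eq_of_isReal τ hΛreal hEreal h hLdeg hQdeg S hS hs hline hann
      (D := (D : Multiset X)) hsD' x
    convert this
  · intro h
    exact isReal_of_count_eq hgenus τ hΛreal hEreal hEgen hLdeg hQdeg S hS (D := (D : Multiset X))
      D.2 hs hann hsD' (fun x => by convert h x)
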